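/- Let $X=(X_t)_{t\ge 0}$ be a real-valued Lévy process with $X_0=0$ on a probability space $(\Omega,\mathcal F,P)$ such that $E(e^{2X_1})<\infty$, $E(|X_1|^n)<\infty$ for $n\in\{1,\dots,5\}$ and $\operatorname{Var}(X_1)>0$. Put $\mu:=E(X_1)$, $\sigma:=\sqrt{\operatorname{Var}(X_1)}$ and $D:=\{y\in\mathbb C: E(e^{\operatorname{Re}(y)X_1})<\infty\}$, and let $R\in\mathbb R\setminus\{0\}$ satisfy $2R\in\operatorname{int}D$. Define $$X^\lambda_t:=\Bigl(1-\frac1\lambda\Bigr)\mu t+\lambda X_{t/\lambda^2}\quad(\lambda\in(0,1]),\qquad X^0_t:=\mu t+\sigma W_t,\qquad t\ge 0,$$ where $W$ is a standard Brownian motion (possibly on another probability space). For $\lambda\in[0,1]$ let $D^\lambda:=\{y\in\mathbb C: E(e^{\operatorname{Re}(y)X^\lambda_1})<\infty\}$ and let $\kappa^\lambda:D^\lambda\to\mathbb C$ be the cumulant generating function of $X^\lambda$, that is, the unique continuous function with $E(e^{zX^\lambda_t})=e^{t\kappa^\lambda(z)}$ for all $t\ge 0$ and $z\in D^\lambda$.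 Then, for every $\lambda\in[0,1]$, the function $\kappa^\lambda$ exists and $\{0,R,2R\}+i\mathbb R\subset D^\lambda$. The mapping $\kappa:[0,1]\times(\{0,R,2R\}+i\mathbb R)\to\mathbb C$, $(\lambda,z)\mapsto\kappa^\lambda(z)$, is twice partially differentiable with respect to $\lambda$ (one-sidedly at $\lambda=0$ and $\lambda=1$), and $\kappa$, $\frac{\partial}{\partial\lambda}\kappa$, $\frac{\partial^2}{\partial\lambda^2}\kappa$ are continuous on $[0,1]\times(\{0,R,2R\}+i\mathbb R)$. For all $z\in\{0,R,2R\}+i\mathbb R$, \begin{align*} \kappa^0(z)&=\mu z+\tfrac12\sigma^2z^2,\\ \frac{\partial}{\partial\lambda}\kappa^\lambda(z)\Big|_{\lambda=0}&=\tfrac16E\bigl((X_1-\mu)^3\bigr)z^3,\\ \frac{\partial^2}{\partial\lambda^2}\kappa^\lambda(z)\Big|_{\lambda=0}&=\tfrac1{12}\bigl(E\bigl((X_1-\mu)^4\bigr)-3\sigma^4\bigr)z^4. \end{align*} Moreover, there is a constant $c_1>0$, not depending on $\lambda$, $z$, $n$, such that $$\Bigl|\frac{\partial^n}{\partial\lambda^n}\kappa^\lambda(z)\Bigr|\le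 c_1\bigl(1+|z|^{3+n}\bigr)\quad\text{for all }(\lambda,z)\in[0,1]\times(\{0,R,2R\}+i\mathbb R),\ n\in\{0,1,2\}.$$ -/

import Mathlib

open MeasureTheory ProbabilityTheory Filter Topology Set
open scoped NNReal

noncomputable section

/-- A real-valued Lévy process (started at `0`), indexed by `ℝ≥0`, on `(Ω, P)`. -/
structure IsLevyProcess {Ω : Type*} [MeasurableSpace Ω] (X : ℝ≥0 → Ω → ℝ) (P : Measure Ω) :
    Prop where
  measurable : ∀ t, Measurable (X t)
  zero : ∀ᵐ ω ∂P, X 0 ω = 0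
  indep_increments : HasIndepIncrements X P
  stationary_increments : ∀ s t : ℝ≥0,
    IdentDistrib (fun ω ↦ X (s + t) ω - X s ω) (fun ω ↦ X t ω - X 0 ω) P P
  stochastically_continuous : ∀ t : ℝ≥0, TendstoInMeasure P X (𝓝 t) (X t)
  cadlag : ∀ᵐ ω ∂P, ∀ t : ℝ≥0,
    ContinuousWithinAt (fun s ↦ X s ω) (Ici t) t ∧
      ∃ l : ℝ, Tendsto (fun s ↦ X s ω) (𝓝[<] t) (𝓝 l)

/-- `{y ∈ ℂ | E[exp (Re y · Y₁)] < ∞}`. -/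
def expDomain {Ω : Type*} [MeasurableSpace Ω] (Y : ℝ≥0 → Ω → ℝ) (P : Measure Ω) : Set ℂ :=
  {y | Integrable (fun ω ↦ Real.exp (y.re * Y 1 ω)) P}

/-- `κ` is a cumulant generating function of `Y`: it is continuous on the domain of `Y`, and
`E[exp (z Y_t)] = exp (t κ(z))` for all `t ≥ 0` and all `z` in the domain. -/
def IsCumulantGenFun {Ω : Type*} [MeasurableSpace Ω] (Y : ℝ≥0 → Ω → ℝ) (P : Measure Ω)
    (κ : ℂ → ℂ) : Prop :=
  ContinuousOn κ (expDomain Y P) ∧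
    ∀ t : ℝ≥0, ∀ z ∈ expDomain Y P,
      ∫ ω, Complex.exp (z * (Y t ω : ℂ)) ∂P = Complex.exp ((t : ℂ) * κ z)

open Classical in
/-- The cumulant generating function of `Y`, if there is one (it is then unique on the domain of
`Y`, see `IsCumulantGenFun.eqOn`), and `0` otherwise. -/
def cumulantGenFun {Ω : Type*} [MeasurableSpace Ω] (Y : ℝ≥0 → Ω → ℝ) (P : Measure Ω) : ℂ → ℂ :=
  if h : ∃ κ, IsCumulantGenFun Y P κ then h.choose else 0

theorem IsCumulantGenFun.eqOn {Ω : Type*} [MeasurableSpace Ω] {Y : ℝ≥0 → Ω → ℝ} {P : Measure Ω}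
    {κ κ' : ℂ → ℂ} (h : IsCumulantGenFun Y P κ) (h' : IsCumulantGenFun Y P κ') :
    EqOn κ κ' (expDomain Y P) := by
  intro z hz
  have key : ∀ t : ℝ≥0, Complex.exp ((t : ℂ) * κ z) = Complex.exp ((t : ℂ) * κ' z) := fun t ↦ by
    rw [← h.2 t z hz, ← h'.2 t z hz]
  have hd : ∀ w : ℂ, HasDerivWithinAt (fun t : ℝ ↦ Complex.exp ((t : ℂ) * w)) w (Ici 0) 0 := by
    intro w
    have h1 : HasDerivAt (fun t : ℝ ↦ (t : ℂ) * w) (1 * w) 0 :=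
      (Complex.ofRealCLM.hasDerivAt (x := (0 : ℝ))).mul_const w
    simpa using h1.cexp.hasDerivWithinAt (s := Ici 0)
  refine (uniqueDiffOn_Ici (0 : ℝ) 0 self_mem_Ici).eq_deriv _ (hd (κ z)) ?_
  refine (hd (κ' z)).congr (fun t ht ↦ ?_) ?_
  · exact key ⟨t, ht⟩
  · simp

/-- `X^l_t = (1 - 1/l) μ t + l X_{t/l²}` with `μ = E[X₁]`, for `l ∈ (0, 1]`. -/
def scaledProcess {Ω : Type*} [MeasurableSpace Ω] (X : ℝ≥0 → Ω → ℝ) (P : Measure Ω) (l : ℝ) :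
    ℝ≥0 → Ω → ℝ :=
  fun t ω ↦ (1 - 1 / l) * (∫ ω', X 1 ω' ∂P) * (t : ℝ) + l * X (t / l.toNNReal ^ 2) ω

/-- Brownian motion with drift, `μ t + σ W_t`. -/
def driftedProcess {Ω' : Type*} (μ σ : ℝ) (W : ℝ≥0 → Ω' → ℝ) : ℝ≥0 → Ω' → ℝ :=
  fun t ω ↦ μ * (t : ℝ) + σ * W t ω

/-- The family `κ^l`, `l ∈ [0, 1]`, of cumulant generating functions of the curve of Lévy processes
that joins `X^0 = μ t + σ W_t` (on a space of its own), where `μ = E[X₁]`, `σ = √Var[X₁]`,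
to `X^1 = X`. -/
def kappaFamily {Ω Ω' : Type*} [MeasurableSpace Ω] [MeasurableSpace Ω']
    (X : ℝ≥0 → Ω → ℝ) (P : Measure Ω) (W : ℝ≥0 → Ω' → ℝ) (P' : Measure Ω') (l : ℝ) : ℂ → ℂ :=
  if l = 0 then cumulantGenFun (driftedProcess (∫ ω, X 1 ω ∂P) √(variance (X 1) P) W) P'
  else cumulantGenFun (scaledProcess X P l) P

/-- The three vertical lines `{0, R, 2R} + iℝ` in `ℂ`. -/
def verticalLines (R : ℝ) : Set ℂ :=
  {z | z.re ∈ ({0, R, 2 * R} : Set ℝ)}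

end

/-! Write `κ` for the cumulant generating function of `X`. For `λ > 0` the scaled process has
`κ^λ(z) = (1 - 1/λ) μ z + λ⁻² κ(λ z)`. Since `κ(0) = 0` and `κ'(0) = μ`, Taylor's formula with
integral remainder cancels the singular terms and leaves `κ^λ(z) = μ z + z² ∫₀¹ (1 - s) κ''(s λ z)
ds`. At `λ = 0` the right side is the Brownian exponent `μ z + σ² z² / 2`, and differentiating under
the integral gives `∂ⁿ/∂λⁿ` as `zⁿ⁺² ∫₀¹ (1 - s) sⁿ κ⁽ⁿ⁺²⁾(s λ z) ds` for `n = 1, 2`. Everything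
thus reduces to facts about `κ` on the closed strip between the real parts `0` and `2R`: it exists,
it has four derivatives, and the second to fourth are continuous and bounded there.

Existence (`exists_isCumulantGenFun`): for fixed `z` the function `t ↦ E[exp (z X_t)]` is
multiplicative and continuous, hence an exponential. Its rate is a quotient of expressions
continuous in `z`.

Derivatives: `κ` is a continuous logarithm of `E[exp (z X_1)]`, so its derivatives are the cumulants
`tiltedCumulant` of the tilted law. The line `Re z = 0` may bound the domain, so they are taken
within the strip.

Boundedness (`exists_norm_tiltedCumulant_le`) is the main point, as the strip is not compact. It
comes without a Lévy–Khintchine formula: for `n ≥ 2`, `κ⁽ⁿ⁾(z)` is the limit of `E[X_tⁿ exp (z X_t)]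
/ t` as `t → 0`, and these moments are dominated by absolute moments at `Re z`. The real segment is
compact. -/

/-! ### Multiplicative functions on the half-line -/

/-- A positive multiplicative function on `ℝ≥0` that is bounded away from `0` near `0` is
continuous. -/
theorem NNReal.continuous_of_map_add_eq_mul_of_le {f : ℝ≥0 → ℝ} (hpos : ∀ t, 0 < f t)
    (hmul : ∀ s t, f (s + t) = f s * f t) {δ : ℝ≥0} (hδ : 0 < δ) {c : ℝ} (hc : 0 < c)
    (hle : ∀ t ≤ δ, c ≤ f t) : Continuous f := by
  have hadd : ∀ s t, Real.log (f (s + t)) = Real.log (f s) + Real.log (f t) := fun s t ↦ by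
    rw [hmul, Real.log_mul (hpos s).ne' (hpos t).ne']
  obtain ⟨C, hC⟩ : ∃ C, ∀ t ≤ δ, |Real.log (f t)| ≤ C := by
    refine ⟨|Real.log c| + |Real.log (f δ)|, fun t ht ↦ ?_⟩
    have h1 := Real.log_le_log hc (hle t ht)
    -- The lower bound at `δ - t` becomes an upper bound at `t`, because the two logarithms add up
    -- to `log (f δ)`.
    have h2 := Real.log_le_log hc (hle (δ - t) tsub_le_self)
    have h3 := hadd t (δ - t)
    rw [add_tsub_cancel_of_le ht] at h3
    rw [abs_le]
    constructor <;> linarith [neg_abs_le (Real.log c), neg_abs_le (Real.log (f δ)),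
      le_abs_self (Real.log c), le_abs_self (Real.log (f δ)), abs_nonneg (Real.log c),
      abs_nonneg (Real.log (f δ))]
  have hnsmul : ∀ (n : ℕ) (t : ℝ≥0), Real.log (f (n * t)) = n * Real.log (f t) := by
    intro n t
    induction n with
    | zero =>
      have := hadd 0 0
      simp only [add_zero] at this
      simp only [CharP.cast_eq_zero, zero_mul]
      linarith
    | succ n ih =>
      push_cast
      rw [add_mul, one_mul, hadd, ih]
      ring
  have hcont : Continuous (fun t ↦ Real.log (f t)) := by
    rw [Metric.continuous_iff]
    intro t ε hε
    obtain ⟨n, hn⟩ := exists_nat_gt (C / ε)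
    have hC0 : 0 ≤ C := (abs_nonneg _).trans (hC 0 zero_le)
    have hn0 : 0 < (n : ℝ) := (div_nonneg hC0 hε.le).trans_lt hn
    have hn0' : 0 < (n : ℝ≥0) := by exact_mod_cast hn0
    -- Here `n * log (f h) = log (f (n * h))` is at most `C` in absolute value, and `n > C / ε`.
    have hsmall : ∀ h : ℝ≥0, (n : ℝ≥0) * h ≤ δ → |Real.log (f h)| < ε := by
      intro h hh
      have h1 := hC _ hh
      rw [hnsmul, abs_mul, abs_of_pos hn0] at h1
      rw [div_lt_iff₀ hε] at hn
      by_contra! h2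
      nlinarith
    refine ⟨δ / n, by positivity, fun s hs ↦ ?_⟩
    rw [Real.dist_eq]
    rw [NNReal.dist_eq, lt_div_iff₀ hn0] at hs
    have key : ∀ a b : ℝ≥0, a ≤ b → |(a : ℝ) - b| * n < δ →
        |Real.log (f b) - Real.log (f a)| < ε := by
      intro a b hab h
      have h1 := hadd a (b - a)
      rw [add_tsub_cancel_of_le hab] at h1
      rw [h1, add_sub_cancel_left]
      apply hsmall
      rw [← NNReal.coe_le_coe]
      push_cast [NNReal.coe_sub hab]
      rw [abs_sub_comm, abs_of_nonneg (sub_nonneg.2 (NNReal.coe_le_coe.2 hab))] at h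
      linarith
    rcases le_total s t with h | h
    · rw [abs_sub_comm]
      exact key s t h hs
    · rw [abs_sub_comm] at hs
      exact key t s h hs
  have : f = fun t ↦ Real.exp (Real.log (f t)) := by
    ext t
    rw [Real.exp_log (hpos t)]
  rw [this]
  exact Real.continuous_exp.comp hcont

/-- A continuous multiplicative function on `ℝ≥0` is an exponential, with an explicit rate. -/
theorem NNReal.eq_exp_of_continuous_of_map_add_eq_mul {f : ℝ≥0 → ℂ} (hf : Continuous f)
    (h0 : f 0 = 1) (hmul : ∀ s t, f (s + t) = f s * f t) {δ : ℝ≥0}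
    (hδ : ∫ s in (0 : ℝ)..δ, f s.toNNReal ≠ 0) (t : ℝ≥0) :
    f t = Complex.exp (t * ((f δ - 1) / ∫ s in (0 : ℝ)..δ, f s.toNNReal)) := by
  set I := ∫ s in (0 : ℝ)..δ, f s.toNNReal with hI
  set k := (f δ - 1) / I with hk
  set g : ℝ → ℂ := fun s ↦ f s.toNNReal with hg
  have hgc : Continuous g := hf.comp continuous_real_toNNReal
  -- Up to the nonzero constant `I`, `g` is the integral of itself over a moving window, so
  -- continuity upgrades to differentiability.
  have hshift : ∀ s : ℝ, 0 ≤ s → g s * I = ∫ r in s..(s + δ), g r := by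
    intro s hs
    have : ∫ r in s..(s + δ), g r = ∫ r in (0 : ℝ)..δ, g (s + r) := by
      rw [intervalIntegral.integral_comp_add_left (fun r ↦ g r) s, add_zero]
    rw [this, hI, ← intervalIntegral.integral_const_mul]
    refine intervalIntegral.integral_congr fun r hr ↦ ?_
    rw [uIcc_of_le δ.coe_nonneg] at hr
    simp only [hg]
    rw [Real.toNNReal_add hs hr.1, hmul]
  have hderiv : ∀ s : ℝ, 0 ≤ s → HasDerivWithinAt g (g s * k) (Ici s) s := by
    intro s hs
    have hF : ∀ x : ℝ, HasDerivAt (fun u ↦ ∫ r in (0 : ℝ)..u, g r) (g x) x := fun x ↦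
      intervalIntegral.integral_hasDerivAt_right (hgc.intervalIntegrable _ _)
        (hgc.stronglyMeasurableAtFilter _ _) hgc.continuousAt
    have h1 : HasDerivAt (fun u ↦ ((∫ r in (0 : ℝ)..(u + δ), g r) - ∫ r in (0 : ℝ)..u, g r) / I)
        ((g (s + δ) - g s) / I) s :=
      (((hF (s + δ)).comp_add_const s δ).sub (hF s)).div_const I
    have h2 : (g (s + δ) - g s) / I = g s * k := by
      simp only [hg, hk]
      rw [Real.toNNReal_add hs δ.coe_nonneg, hmul, Real.toNNReal_coe]
      ring
    rw [h2] at h1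
    have h3 : ∀ u ∈ Ici s,
        g u = ((∫ r in (0 : ℝ)..(u + δ), g r) - ∫ r in (0 : ℝ)..u, g r) / I := by
      intro u hu
      rw [intervalIntegral.integral_interval_sub_left (hgc.intervalIntegrable _ _)
        (hgc.intervalIntegrable _ _), ← hshift u (hs.trans hu), mul_div_cancel_right₀ _ hδ]
    exact h1.hasDerivWithinAt.congr h3 (h3 s self_mem_Ici)
  have hexp : ∀ s : ℝ, HasDerivAt (fun u : ℝ ↦ Complex.exp (-(u * k)))
      (Complex.exp (-(s * k)) * (-(1 * k))) s := fun s ↦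
    ((Complex.ofRealCLM.hasDerivAt (x := s)).mul_const k).neg.cexp
  have hconst := constant_of_has_deriv_right_zero (f := fun u : ℝ ↦ g u * Complex.exp (-(u * k)))
    (a := 0) (b := t) (by fun_prop) (fun s hs ↦
      ((hderiv s hs.1).mul (hexp s).hasDerivWithinAt).congr_deriv (by ring)) t ⟨t.coe_nonneg, le_rfl⟩
  simp only [hg, Real.toNNReal_coe, Real.toNNReal_zero, h0, Complex.ofReal_zero, zero_mul, neg_zero,
    Complex.exp_zero, mul_one, Complex.exp_neg] at hconst
  exact (mul_inv_eq_one₀ (Complex.exp_ne_zero _)).1 hconst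

/-- A single `t > 0` determines the rate only modulo `2πi / t`; the derivative at `t = 0` removes
the ambiguity. -/
theorem Complex.eq_of_forall_exp_mul_eq {k k' : ℂ}
    (h : ∀ t : ℝ≥0, Complex.exp (t * k) = Complex.exp (t * k')) : k = k' := by
  have hrate : ∀ k : ℂ, HasDerivWithinAt (fun t : ℝ ↦ Complex.exp (t * k)) k (Ici 0) 0 := by
    intro k
    have h1 : HasDerivAt (fun t : ℝ ↦ (t : ℂ) * k) (1 * k) 0 :=
      (Complex.ofRealCLM.hasDerivAt (x := (0 : ℝ))).mul_const k
    simpa using h1.cexp.hasDerivWithinAt (s := Ici 0)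
  exact (uniqueDiffOn_Ici (0 : ℝ) 0 self_mem_Ici).eq_deriv _ (hrate k)
    ((hrate k').congr (fun t ht ↦ h ⟨t, ht⟩) (by simp))

theorem exists_integral_ne_zero_of_continuous {f : ℝ≥0 → ℂ} (hf : Continuous f) (h0 : f 0 ≠ 0) :
    ∃ δ : ℝ≥0, ∫ s in (0 : ℝ)..δ, f s.toNNReal ≠ 0 := by
  have hgc : Continuous (fun s : ℝ ↦ f s.toNNReal) := hf.comp continuous_real_toNNReal
  have hd : HasDerivAt (fun u ↦ ∫ r in (0 : ℝ)..u, f r.toNNReal) (f (0 : ℝ).toNNReal) 0 :=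
    intervalIntegral.integral_hasDerivAt_right (hgc.intervalIntegrable _ _)
      (hgc.stronglyMeasurableAtFilter _ _) hgc.continuousAt
  have hne := hd.eventually_ne (c := 0) (by simpa using h0)
  have hev : ∀ᶠ u : ℝ in 𝓝[>] 0, ∫ r in (0 : ℝ)..u, f r.toNNReal ≠ 0 :=
    hne.filter_mono (nhdsWithin_mono _ fun x hx ↦ ne_of_gt hx)
  obtain ⟨u, hu, hu0⟩ := (hev.and self_mem_nhdsWithin).exists
  exact ⟨⟨u, le_of_lt hu0⟩, hu⟩

/-! ### Exponential moments of a Lévy process as functions of time -/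

/-- Dominated convergence for an integrable weight times a bounded continuous function of a
process that converges in measure. -/
theorem MeasureTheory.TendstoInMeasure.tendsto_integral_mul {Ω ι 𝕜 : Type*} [MeasurableSpace Ω]
    [RCLike 𝕜] {P : Measure Ω} {l : Filter ι} [l.IsCountablyGenerated] {X : ι → Ω → ℝ} {Y : Ω → ℝ}
    (hX : ∀ i, Measurable (X i)) (h : TendstoInMeasure P X l Y) {g : Ω → 𝕜} (hg : Integrable g P)
    {φ : ℝ → 𝕜} (hφ : Continuous φ) (hb : ∀ x, ‖φ x‖ ≤ 1) :
    Tendsto (fun i ↦ ∫ ω, g ω * φ (X i ω) ∂P) l (𝓝 (∫ ω, g ω * φ (Y ω) ∂P)) := by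
  refine tendsto_of_seq_tendsto fun u hu ↦ tendsto_of_subseq_tendsto fun ns hns ↦ ?_
  obtain ⟨ms, -, hms⟩ := (h.comp (hu.comp hns)).exists_seq_tendsto_ae
  refine ⟨ms, tendsto_integral_of_dominated_convergence (fun ω ↦ ‖g ω‖) (fun n ↦ ?_) hg.norm
    (fun n ↦ ae_of_all _ fun ω ↦ ?_) ?_⟩
  · exact hg.1.mul (hφ.measurable.comp (hX _)).aestronglyMeasurable
  · rw [norm_mul]
    exact mul_le_of_le_one_right (norm_nonneg _) (hb _)
  · filter_upwards [hms] with ω hω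
    exact ((hφ.tendsto _).comp hω).const_mul _

namespace IsLevyProcess

variable {Ω : Type*} [MeasurableSpace Ω] {P : Measure Ω} {X : ℝ≥0 → Ω → ℝ}

theorem identDistrib_sub (hX : IsLevyProcess X P) (s t : ℝ≥0) :
    IdentDistrib (X (s + t) - X s) (X t) P P := by
  refine (hX.stationary_increments s t).trans (IdentDistrib.of_ae_eq
    ((hX.measurable t).sub (hX.measurable 0)).aemeasurable ?_)
  filter_upwards [hX.zero] with ω hω
  simp [hω]

theorem indepFun_sub (hX : IsLevyProcess X P) (s t : ℝ≥0) :
    IndepFun (X s) (X (s + t) - X s) P :=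
  hX.indep_increments.indepFun_eval_sub zero_le le_self_add hX.zero

theorem integrable_exp_mul_sub_iff (hX : IsLevyProcess X P) (s t : ℝ≥0) (u : ℝ) :
    Integrable (fun ω ↦ Real.exp (u * (X (s + t) - X s) ω)) P ↔
      Integrable (fun ω ↦ Real.exp (u * X t ω)) P :=
  ((hX.identDistrib_sub s t).comp (u := fun x ↦ Real.exp (u * x)) (by fun_prop)).integrable_iff

theorem integrable_exp_mul_add (hX : IsLevyProcess X P) {s t : ℝ≥0} {u : ℝ}
    (hs : Integrable (fun ω ↦ Real.exp (u * X s ω)) P)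
    (ht : Integrable (fun ω ↦ Real.exp (u * X t ω)) P) :
    Integrable (fun ω ↦ Real.exp (u * X (s + t) ω)) P := by
  simpa using (hX.indepFun_sub s t).integrable_exp_mul_add hs
    ((hX.integrable_exp_mul_sub_iff s t u).2 ht)

theorem mgf_add (hX : IsLevyProcess X P) (s t : ℝ≥0) (u : ℝ) :
    mgf (X (s + t)) P u = mgf (X s) P u * mgf (X t) P u := by
  have hm := hX.measurable
  have h := (hX.indepFun_sub s t).mgf_add' (t := u) (hm s).aestronglyMeasurable
    ((hm (s + t)).sub (hm s)).aestronglyMeasurable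
  rwa [add_sub_cancel, mgf_congr_identDistrib (hX.identDistrib_sub s t)] at h

/-- Two separate exponents are allowed because `continuous_complexMGF` uses `z` up to time `s` and
`z.re` afterwards. -/
theorem integral_cexp_mul_cexp_sub (hX : IsLevyProcess X P) (s t : ℝ≥0) (z w : ℂ) :
    ∫ ω, Complex.exp (z * X s ω) * Complex.exp (w * ((X (s + t) - X s) ω : ℝ)) ∂P =
      complexMGF (X s) P z * complexMGF (X t) P w := by
  have hm := hX.measurable
  rw [← complexMGF_congr_identDistrib (hX.identDistrib_sub s t)]
  exact (hX.indepFun_sub s t).integral_fun_comp_mul_comp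
    (f := fun x : ℝ ↦ Complex.exp (z * x)) (g := fun x : ℝ ↦ Complex.exp (w * x))
    (hm s).aemeasurable ((hm (s + t)).sub (hm s)).aemeasurable
    (by fun_prop) (by fun_prop)

theorem complexMGF_add (hX : IsLevyProcess X P) (s t : ℝ≥0) (z : ℂ) :
    complexMGF (X (s + t)) P z = complexMGF (X s) P z * complexMGF (X t) P z := by
  rw [← hX.integral_cexp_mul_cexp_sub s t z z, complexMGF]
  congr with ω
  rw [← Complex.exp_add, Pi.sub_apply]
  push_cast
  ring_nf

variable [IsProbabilityMeasure P]

/-- The exponential at time `t` is a product of independent factors, one of them the exponential at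
time `s`. If the product is integrable and the other factor is not a.e. zero, the factor at time `s`
is integrable. -/
theorem integrable_exp_mul_of_le (hX : IsLevyProcess X P) {s t : ℝ≥0} (hst : s ≤ t) {u : ℝ}
    (ht : Integrable (fun ω ↦ Real.exp (u * X t ω)) P) :
    Integrable (fun ω ↦ Real.exp (u * X s ω)) P := by
  obtain ⟨r, rfl⟩ := le_iff_exists_add.1 hst
  have hm := hX.measurable
  refine ((hX.indepFun_sub s r).exp_mul u u).integrable_left_of_integrable_op (fun x y ↦ x * y) 1
    one_ne_zero (fun x y ↦ by simp) ?_ ?_ ?_ fun h ↦ ?_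
  · refine ht.congr (ae_of_all _ fun ω ↦ ?_)
    simp only [Pi.sub_apply]
    rw [← Real.exp_add]
    ring_nf
  · exact (((hm s).const_mul u).exp).aestronglyMeasurable
  · exact (((hm (s + r)).sub (hm s)).const_mul u).exp.aestronglyMeasurable
  · obtain ⟨ω, hω⟩ := h.exists
    exact (Real.exp_pos _).ne' hω

theorem integrable_exp_mul (hX : IsLevyProcess X P) {u : ℝ}
    (hu : u ∈ integrableExpSet (X 1) P) (t : ℝ≥0) :
    Integrable (fun ω ↦ Real.exp (u * X t ω)) P := by
  obtain ⟨n, hn⟩ := exists_nat_ge t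
  refine hX.integrable_exp_mul_of_le hn ?_
  clear hn
  induction n with
  | zero =>
    refine (integrable_const (1 : ℝ)).congr ?_
    filter_upwards [hX.zero] with ω hω
    simp [hω]
  | succ n ih =>
    push_cast
    exact hX.integrable_exp_mul_add ih hu

theorem integrableExpSet_eq (hX : IsLevyProcess X P) {t : ℝ≥0} (ht : 1 ≤ t) :
    integrableExpSet (X t) P = integrableExpSet (X 1) P :=
  Subset.antisymm (fun _ hu ↦ hX.integrable_exp_mul_of_le ht hu)
    fun _ hu ↦ hX.integrable_exp_mul hu t

theorem complexMGF_zero (hX : IsLevyProcess X P) (z : ℂ) : complexMGF (X 0) P z = 1 := by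
  have : ∫ ω, Complex.exp (z * X 0 ω) ∂P = ∫ _, (1 : ℂ) ∂P := by
    refine integral_congr_ae ?_
    filter_upwards [hX.zero] with ω hω
    simp [hω]
  simpa [complexMGF] using this

/-- Convergence in measure gives no uniform integrability. It does apply to the truncation `min 1
(exp (u x))`, which bounds the moment generating function below by `1/2` near time `0`; for a
positive multiplicative function that is enough. -/
theorem continuous_mgf (hX : IsLevyProcess X P) {u : ℝ} (hu : u ∈ integrableExpSet (X 1) P) :
    Continuous (fun t ↦ mgf (X t) P u) := by
  have hlim := (hX.stochastically_continuous 0).tendsto_integral_mul hX.measurable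
    (integrable_const (1 : ℝ)) (φ := fun x ↦ min 1 (Real.exp (u * x))) (by fun_prop) (fun x ↦ by
      rw [Real.norm_of_nonneg (le_min zero_le_one (Real.exp_pos _).le)]
      exact min_le_left _ _)
  have h1 : ∫ ω, 1 * min 1 (Real.exp (u * X 0 ω)) ∂P = 1 := by
    have : ∫ ω, 1 * min 1 (Real.exp (u * X 0 ω)) ∂P = ∫ _, (1 : ℝ) ∂P := by
      refine integral_congr_ae ?_
      filter_upwards [hX.zero] with ω hω
      simp [hω]
    simpa using this
  rw [h1] at hlim
  obtain ⟨ε, hε, hball⟩ := Metric.eventually_nhds_iff.1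
    (hlim.eventually (lt_mem_nhds (one_half_lt_one (α := ℝ))))
  refine NNReal.continuous_of_map_add_eq_mul_of_le
    (fun t ↦ mgf_pos (hX.integrable_exp_mul hu t)) (fun s t ↦ hX.mgf_add s t u)
    (δ := ⟨ε / 2, by positivity⟩) (half_pos hε : 0 < ε / 2)
    (one_half_pos (α := ℝ)) fun t ht ↦ ?_
  have ht' : dist t 0 < ε := by
    rw [NNReal.dist_eq, NNReal.coe_zero, sub_zero, abs_of_nonneg t.coe_nonneg]
    have : (t : ℝ) ≤ ε / 2 := ht
    linarith
  refine (hball ht').le.trans (integral_mono_of_nonneg (ae_of_all _ fun ω ↦ ?_)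
    (hX.integrable_exp_mul hu t) (ae_of_all _ fun ω ↦ ?_))
  · have := (Real.exp_pos (u * X t ω)).le
    simp [this]
  · simp

/-- Weighting by `exp (z.re * X T)` at one fixed time `T > t` supplies an integrable majorant, so
that only the bounded oscillating factor depends on `s`. Independence after `s` turns the weight
into a division by the continuous, positive moment generating function at time `T - s`. -/
theorem continuous_complexMGF (hX : IsLevyProcess X P) {z : ℂ}
    (hz : z.re ∈ integrableExpSet (X 1) P) : Continuous (fun t ↦ complexMGF (X t) P z) := by
  rw [continuous_iff_continuousAt]
  intro t
  set T := t + 1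
  have hlim := (hX.stochastically_continuous t).tendsto_integral_mul (𝕜 := ℂ) hX.measurable
    (hX.integrable_exp_mul hz T).ofReal
    (φ := fun x ↦ Complex.exp (((z.im * x : ℝ) : ℂ) * Complex.I)) (by fun_prop)
    (fun x ↦ (Complex.norm_exp_ofReal_mul_I _).le)
  have key : ∀ s ≤ T, (∫ ω, ((Real.exp (z.re * X T ω) : ℝ) : ℂ) *
      Complex.exp (((z.im * X s ω : ℝ) : ℂ) * Complex.I) ∂P) / mgf (X (T - s)) P z.re =
        complexMGF (X s) P z := by
    intro s hs
    rw [div_eq_iff (by exact_mod_cast (mgf_pos (hX.integrable_exp_mul hz (T - s))).ne'),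
      ← complexMGF_ofReal, ← hX.integral_cexp_mul_cexp_sub s (T - s), add_tsub_cancel_of_le hs]
    congr with ω
    rw [Complex.ofReal_exp, ← Complex.exp_add, ← Complex.exp_add]
    congr 1
    rw [Pi.sub_apply]
    push_cast
    linear_combination (X s ω : ℂ) * Complex.re_add_im z
  have hm : Tendsto (fun s ↦ ((mgf (X (T - s)) P z.re : ℝ) : ℂ)) (𝓝 t)
      (𝓝 (mgf (X (T - t)) P z.re : ℝ)) := by
    have : Continuous (fun s ↦ ((mgf (X (T - s)) P z.re : ℝ) : ℂ)) :=
      Complex.continuous_ofReal.comp ((hX.continuous_mgf hz).comp (by fun_prop))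
    exact this.tendsto t
  have hquot := hlim.div hm
    (by exact_mod_cast (mgf_pos (hX.integrable_exp_mul hz (T - t))).ne')
  have htT : t < T := lt_add_one t
  rw [ContinuousAt, ← key t htT.le]
  refine hquot.congr' ?_
  filter_upwards [Iio_mem_nhds htT] with s hs
  exact key s (le_of_lt hs)

end IsLevyProcess

/-! ### Existence and continuity of the cumulant generating function -/

/-- Every point of a set of reals has a neighbourhood within the set that is contained in a segment
with endpoints in the set. -/
theorem exists_Icc_mem_nhdsWithin {s : Set ℝ} {x : ℝ} (hx : x ∈ s) :
    ∃ a ∈ s, ∃ b ∈ s, Icc a b ∈ 𝓝[s] x := by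
  obtain ⟨a, ha, hal⟩ : ∃ a ∈ s, Ici a ∈ 𝓝[s] x := by
    by_cases h : ∃ a ∈ s, a < x
    · obtain ⟨a, ha, hax⟩ := h
      exact ⟨a, ha, mem_nhdsWithin_of_mem_nhds (Ici_mem_nhds hax)⟩
    · push Not at h
      exact ⟨x, hx, mem_of_superset self_mem_nhdsWithin h⟩
  obtain ⟨b, hb, hbl⟩ : ∃ b ∈ s, Iic b ∈ 𝓝[s] x := by
    by_cases h : ∃ b ∈ s, x < b
    · obtain ⟨b, hb, hxb⟩ := h
      exact ⟨b, hb, mem_nhdsWithin_of_mem_nhds (Iic_mem_nhds hxb)⟩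
    · push Not at h
      exact ⟨x, hx, mem_of_superset self_mem_nhdsWithin h⟩
  exact ⟨a, ha, b, hb, inter_mem hal hbl⟩

theorem Real.exp_mul_le_add_of_mem_Icc {a b u : ℝ} (hu : u ∈ Icc a b) (x : ℝ) :
    Real.exp (u * x) ≤ Real.exp (a * x) + Real.exp (b * x) := by
  rcases le_total 0 x with h | h
  · have := Real.exp_le_exp.2 (mul_le_mul_of_nonneg_right hu.2 h)
    linarith [Real.exp_pos (a * x)]
  · have := Real.exp_le_exp.2 (mul_le_mul_of_nonpos_right hu.1 h)
    linarith [Real.exp_pos (b * x)]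

theorem expDomain_eq_preimage {Ω : Type*} [MeasurableSpace Ω] (Y : ℝ≥0 → Ω → ℝ) (P : Measure Ω) :
    expDomain Y P = Complex.re ⁻¹' integrableExpSet (Y 1) P := rfl

/-- The domain need not be open. Endpoints `a`, `b` inside it still give the integrable majorant
`exp (a x) + exp (b x)` near `z`, also when `z` is a boundary point. -/
theorem exists_re_mem_Icc_of_mem_expDomain {Ω : Type*} [MeasurableSpace Ω] {Y : ℝ≥0 → Ω → ℝ}
    {P : Measure Ω} {z : ℂ} (hz : z ∈ expDomain Y P) :
    ∃ a ∈ integrableExpSet (Y 1) P, ∃ b ∈ integrableExpSet (Y 1) P,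
      ∀ᶠ w in 𝓝[expDomain Y P] z, w.re ∈ Icc a b := by
  obtain ⟨a, ha, b, hb, hab⟩ :=
    exists_Icc_mem_nhdsWithin (s := integrableExpSet (Y 1) P) (x := z.re) hz
  refine ⟨a, ha, b, hb, ?_⟩
  have : Tendsto Complex.re (𝓝[expDomain Y P] z) (𝓝[integrableExpSet (Y 1) P] z.re) :=
    tendsto_nhdsWithin_iff.2 ⟨Complex.continuous_re.continuousWithinAt,
      eventually_mem_nhdsWithin⟩
  exact this hab

namespace IsLevyProcess

variable {Ω : Type*} [MeasurableSpace Ω] {P : Measure Ω} {X : ℝ≥0 → Ω → ℝ} [IsProbabilityMeasure P]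

theorem continuousOn_complexMGF (hX : IsLevyProcess X P) (t : ℝ≥0) :
    ContinuousOn (complexMGF (X t) P) (expDomain X P) := by
  intro z hz
  obtain ⟨a, ha, b, hb, hab⟩ := exists_re_mem_Icc_of_mem_expDomain hz
  refine tendsto_integral_filter_of_dominated_convergence
    (fun ω ↦ Real.exp (a * X t ω) + Real.exp (b * X t ω))
    (Eventually.of_forall fun w ↦ ?_) ?_
    ((hX.integrable_exp_mul ha t).add (hX.integrable_exp_mul hb t))
    (ae_of_all _ fun ω ↦ ?_)
  · have := hX.measurable t
    exact Measurable.aestronglyMeasurable (by fun_prop)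
  · filter_upwards [hab] with w hw
    refine ae_of_all _ fun ω ↦ ?_
    rw [Complex.norm_exp, Complex.re_mul_ofReal]
    exact Real.exp_mul_le_add_of_mem_Icc hw _
  · have : Continuous (fun w : ℂ ↦ Complex.exp (w * X t ω)) := by fun_prop
    exact this.continuousWithinAt

theorem exists_isCumulantGenFun (hX : IsLevyProcess X P) : ∃ κ, IsCumulantGenFun X P κ := by
  have hex : ∀ z ∈ expDomain X P, ∃ k : ℂ, ∀ t : ℝ≥0, complexMGF (X t) P z = Complex.exp (t * k) :=
    fun z hz ↦ by
      obtain ⟨δ, hδ⟩ := exists_integral_ne_zero_of_continuous (hX.continuous_complexMGF hz)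
        (by simp [hX.complexMGF_zero])
      exact ⟨_, NNReal.eq_exp_of_continuous_of_map_add_eq_mul (hX.continuous_complexMGF hz)
        (hX.complexMGF_zero z) (fun s t ↦ hX.complexMGF_add s t z) hδ⟩
  choose! κ hκ using hex
  refine ⟨κ, fun z hz ↦ ?_, fun t z hz ↦ hκ z hz t⟩
  have hint : ∀ δ : ℝ≥0, ContinuousWithinAt
      (fun w ↦ ∫ s in (0 : ℝ)..δ, complexMGF (X s.toNNReal) P w) (expDomain X P) z := by
    intro δ
    obtain ⟨a, ha, b, hb, hab⟩ := exists_re_mem_Icc_of_mem_expDomain hz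
    refine intervalIntegral.continuousWithinAt_of_dominated_interval
      (bound := fun s ↦ mgf (X s.toNNReal) P a + mgf (X s.toNNReal) P b) ?_ ?_ ?_ ?_
    · filter_upwards [self_mem_nhdsWithin] with w hw
      exact ((hX.continuous_complexMGF hw).comp continuous_real_toNNReal).aestronglyMeasurable
    · filter_upwards [hab] with w hw
      refine ae_of_all _ fun s _ ↦ norm_complexMGF_le_mgf.trans ?_
      rw [mgf, mgf, mgf, ← integral_add (hX.integrable_exp_mul ha _) (hX.integrable_exp_mul hb _)]
      refine integral_mono_of_nonneg (ae_of_all _ fun ω ↦ (Real.exp_pos _).le)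
        ((hX.integrable_exp_mul ha _).add (hX.integrable_exp_mul hb _))
        (ae_of_all _ fun ω ↦ Real.exp_mul_le_add_of_mem_Icc hw _)
    · exact (((hX.continuous_mgf ha).comp continuous_real_toNNReal).add
        ((hX.continuous_mgf hb).comp continuous_real_toNNReal)).intervalIntegrable _ _
    · exact ae_of_all _ fun s _ ↦ hX.continuousOn_complexMGF _ z hz
  obtain ⟨δ, hδ⟩ := exists_integral_ne_zero_of_continuous (hX.continuous_complexMGF hz)
    (by simp [hX.complexMGF_zero])
  -- `κ` was chosen pointwise; this formula, with the one `δ` belonging to `z`, holds for all nearby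
  -- `w` and shows that the choice is continuous.
  have hformula : ∀ w ∈ expDomain X P, ∫ s in (0 : ℝ)..δ, complexMGF (X s.toNNReal) P w ≠ 0 →
      κ w = (complexMGF (X δ) P w - 1) / ∫ s in (0 : ℝ)..δ, complexMGF (X s.toNNReal) P w := by
    intro w hw hwδ
    have h := NNReal.eq_exp_of_continuous_of_map_add_eq_mul (hX.continuous_complexMGF hw)
      (hX.complexMGF_zero w) (fun s t ↦ hX.complexMGF_add s t w) hwδ
    exact Complex.eq_of_forall_exp_mul_eq fun t ↦ (hκ w hw t).symm.trans (h t)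
  have hne := (hint δ).eventually_ne hδ
  refine ContinuousWithinAt.congr_of_eventuallyEq
    (((hX.continuousOn_complexMGF δ z hz).sub continuousWithinAt_const).div (hint δ) hδ) ?_
    (hformula z hz hδ)
  filter_upwards [hne, self_mem_nhdsWithin] with w hw hwD
  exact hformula w hwD hw

end IsLevyProcess

/-! ### Calculus within convex sets -/

/-- Differentiation under the integral sign on a convex set. -/
theorem hasDerivWithinAt_integral_of_dominated_of_convex {α 𝕜 E : Type*} [MeasurableSpace α]
    [RCLike 𝕜] [NormedAddCommGroup E] [NormedSpace ℝ E] [NormedSpace 𝕜 E]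
    {ν : Measure α} {s : Set 𝕜} (hs : Convex ℝ s)
    {F F' : 𝕜 → α → E} {bound : α → ℝ} (hF : ∀ x ∈ s, Integrable (F x) ν)
    (hbound : Integrable bound ν)
    (hderiv : ∀ᵐ a ∂ν, ∀ x ∈ s, HasDerivWithinAt (fun x ↦ F x a) (F' x a) s x)
    (hle : ∀ᵐ a ∂ν, ∀ x ∈ s, ‖F' x a‖ ≤ bound a) {x₀ : 𝕜} (hx₀ : x₀ ∈ s) :
    HasDerivWithinAt (fun x ↦ ∫ a, F x a ∂ν) (∫ a, F' x₀ a ∂ν) s x₀ := by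
  rw [hasDerivWithinAt_iff_tendsto_slope]
  have hslope : ∀ x ∈ s, slope (fun x ↦ ∫ a, F x a ∂ν) x₀ x =
      ∫ a, slope (fun x ↦ F x a) x₀ x ∂ν := by
    intro x hx
    simp only [slope_def_module]
    rw [integral_smul, integral_sub (hF x hx) (hF x₀ hx₀)]
  have hev : ∀ᶠ x in 𝓝[s \ {x₀}] x₀, x ∈ s \ {x₀} := self_mem_nhdsWithin
  refine Tendsto.congr' (hev.mono fun x hx ↦ (hslope x hx.1).symm) ?_
  refine tendsto_integral_filter_of_dominated_convergence bound (hev.mono fun x hx ↦ ?_)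
    (hev.mono fun x hx ↦ ?_) hbound ?_
  · simp only [slope_def_module]
    exact ((hF x hx.1).sub (hF x₀ hx₀)).1.const_smul _
  · filter_upwards [hderiv, hle] with a hda hla
    -- The mean value inequality bounds the difference quotients by `bound`, so `x₀` may lie on the
    -- boundary.
    have h := Convex.norm_image_sub_le_of_norm_hasDerivWithin_le hda hla hs hx₀ hx.1
    have hpos : 0 < ‖x - x₀‖ := norm_pos_iff.2 (sub_ne_zero.2 hx.2)
    rw [slope_def_module, norm_smul, norm_inv, inv_mul_le_iff₀ hpos, mul_comm]
    exact h
  · filter_upwards [hderiv] with a hda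
    exact hasDerivWithinAt_iff_tendsto_slope.1 (hda x₀ hx₀)

/-- A continuous logarithm of a differentiable function is differentiable. -/
theorem HasDerivWithinAt.of_cexp {f g : ℂ → ℂ} {g' z : ℂ} {s : Set ℂ} (hz : z ∈ s)
    (hg : HasDerivWithinAt g g' s z) (hf : ContinuousWithinAt f s z)
    (h : ∀ w ∈ s, Complex.exp (f w) = g w) : HasDerivWithinAt f (g' / g z) s z := by
  have hz0 : g z ≠ 0 := h z hz ▸ Complex.exp_ne_zero _
  have hlog : HasDerivWithinAt (fun w ↦ Complex.log (g w / g z)) (g' / g z) s z := by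
    simpa [hz0] using (hg.div_const (g z)).clog (by simp [hz0])
  refine (hlog.const_add (f z)).congr_of_eventuallyEq ?_ (by simp [hz0])
  -- Near `z` the imaginary part of `f w - f z` stays in `(-π, π)`, where the principal logarithm
  -- inverts the exponential.
  have hlim : Tendsto (fun w ↦ (f w - f z).im) (𝓝[s] z) (𝓝 0) := by
    have := (Complex.continuous_im.tendsto _).comp (hf.sub (continuousWithinAt_const (b := f z)))
    simpa [Function.comp_def] using this
  filter_upwards [hlim.eventually (Ioo_mem_nhds (neg_neg_of_pos Real.pi_pos) Real.pi_pos),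
    self_mem_nhdsWithin] with w hw hws
  rw [← h w hws, ← h z hz, ← Complex.exp_sub, Complex.log_exp hw.1 hw.2.le]
  ring

/-! ### Tilted moments and cumulants on the strip -/

noncomputable section

/-- The closed vertical strip between the real parts `0` and `a`. -/
def verticalStrip (a : ℝ) : Set ℂ := Complex.re ⁻¹' uIcc 0 a

/-- `E[Yⁿ exp (z Y)]`. -/
def expMoment {Ω : Type*} [MeasurableSpace Ω] (Y : Ω → ℝ) (P : Measure Ω) (n : ℕ) (z : ℂ) : ℂ :=
  ∫ ω, (Y ω : ℂ) ^ n * Complex.exp (z * Y ω) ∂P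

/-- The `n`-th moment of `Y` under the (complex) exponentially tilted measure. -/
def tiltedMoment {Ω : Type*} [MeasurableSpace Ω] (Y : Ω → ℝ) (P : Measure Ω) (n : ℕ) (z : ℂ) : ℂ :=
  expMoment Y P n z / expMoment Y P 0 z

/-- The `n`-th cumulant of `Y` under the (complex) exponentially tilted measure, for
`1 ≤ n ≤ 4`. -/
def tiltedCumulant {Ω : Type*} [MeasurableSpace Ω] (Y : Ω → ℝ) (P : Measure Ω) :
    ℕ → ℂ → ℂ
  | 1, z => tiltedMoment Y P 1 z
  | 2, z => tiltedMoment Y P 2 z - tiltedMoment Y P 1 z ^ 2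
  | 3, z => tiltedMoment Y P 3 z - 3 * tiltedMoment Y P 1 z * tiltedMoment Y P 2 z
      + 2 * tiltedMoment Y P 1 z ^ 3
  | 4, z => tiltedMoment Y P 4 z - 4 * tiltedMoment Y P 1 z * tiltedMoment Y P 3 z
      - 3 * tiltedMoment Y P 2 z ^ 2 + 12 * tiltedMoment Y P 1 z ^ 2 * tiltedMoment Y P 2 z
      - 6 * tiltedMoment Y P 1 z ^ 4
  | _, _ => 0

end

theorem convex_verticalStrip (a : ℝ) : Convex ℝ (verticalStrip a) :=
  (convex_uIcc 0 a).linear_preimage Complex.reLm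

theorem smul_mem_verticalStrip {a : ℝ} {z : ℂ} (hz : z ∈ verticalStrip a) {r : ℝ}
    (hr : r ∈ Icc (0 : ℝ) 1) : (r : ℂ) * z ∈ verticalStrip a := by
  have h0 : (0 : ℂ) ∈ verticalStrip a := by simp [verticalStrip]
  simpa using (convex_verticalStrip a).smul_mem_of_zero_mem h0 hz hr

theorem closure_preimage_re_Ioo {a : ℝ} (ha : a ≠ 0) :
    closure (Complex.re ⁻¹' Ioo (min 0 a) (max 0 a)) = verticalStrip a := by
  rw [Complex.closure_preimage_re, closure_Ioo (by simpa using ha.symm), verticalStrip, uIcc]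

theorem Real.exp_mul_le_one_add_of_mem_uIcc {a u : ℝ} (hu : u ∈ uIcc 0 a) (x : ℝ) :
    Real.exp (u * x) ≤ 1 + Real.exp (a * x) := by
  rcases le_total 0 a with h | h
  · rw [uIcc_of_le h] at hu
    simpa using Real.exp_mul_le_add_of_mem_Icc hu x
  · rw [uIcc_of_ge h] at hu
    simpa [add_comm] using Real.exp_mul_le_add_of_mem_Icc hu x

section ExpMoment

variable {Ω : Type*} [MeasurableSpace Ω] {Y : Ω → ℝ} {P : Measure Ω} {a : ℝ}

theorem norm_pow_mul_cexp (n : ℕ) (z : ℂ) (x : ℝ) :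
    ‖(x : ℂ) ^ n * Complex.exp (z * x)‖ = |x| ^ n * Real.exp (z.re * x) := by
  rw [norm_mul, norm_pow, Complex.norm_real, Real.norm_eq_abs, Complex.norm_exp,
    Complex.re_mul_ofReal]

theorem norm_pow_mul_cexp_le {z : ℂ} (hz : z ∈ verticalStrip a) (n : ℕ) (x : ℝ) :
    ‖(x : ℂ) ^ n * Complex.exp (z * x)‖ ≤ |x| ^ n * (1 + Real.exp (a * x)) := by
  rw [norm_pow_mul_cexp]
  exact mul_le_mul_of_nonneg_left (Real.exp_mul_le_one_add_of_mem_uIcc hz x) (by positivity)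

theorem integrable_pow_mul_cexp (hY : Measurable Y) {n : ℕ}
    (h : Integrable (fun ω ↦ |Y ω| ^ n * (1 + Real.exp (a * Y ω))) P)
    {z : ℂ} (hz : z ∈ verticalStrip a) :
    Integrable (fun ω ↦ (Y ω : ℂ) ^ n * Complex.exp (z * Y ω)) P :=
  h.mono' (Measurable.aestronglyMeasurable (by fun_prop))
    (ae_of_all _ fun ω ↦ norm_pow_mul_cexp_le hz n (Y ω))

theorem continuousOn_expMoment (hY : Measurable Y) {n : ℕ}
    (h : Integrable (fun ω ↦ |Y ω| ^ n * (1 + Real.exp (a * Y ω))) P) :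
    ContinuousOn (expMoment Y P n) (verticalStrip a) := by
  intro z hz
  refine tendsto_integral_filter_of_dominated_convergence _
    (Eventually.of_forall fun w ↦ Measurable.aestronglyMeasurable (by fun_prop)) ?_ h
    (ae_of_all _ fun ω ↦ ?_)
  · filter_upwards [self_mem_nhdsWithin] with w hw
    exact ae_of_all _ fun ω ↦ norm_pow_mul_cexp_le hw n (Y ω)
  · have : Continuous (fun w : ℂ ↦ (Y ω : ℂ) ^ n * Complex.exp (w * Y ω)) := by fun_prop
    exact this.continuousWithinAt

theorem hasDerivWithinAt_expMoment (hY : Measurable Y) {n : ℕ}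
    (h : Integrable (fun ω ↦ |Y ω| ^ n * (1 + Real.exp (a * Y ω))) P)
    (h' : Integrable (fun ω ↦ |Y ω| ^ (n + 1) * (1 + Real.exp (a * Y ω))) P)
    {z : ℂ} (hz : z ∈ verticalStrip a) :
    HasDerivWithinAt (expMoment Y P n) (expMoment Y P (n + 1) z) (verticalStrip a) z := by
  refine hasDerivWithinAt_integral_of_dominated_of_convex
    (F' := fun z ω ↦ (Y ω : ℂ) ^ (n + 1) * Complex.exp (z * Y ω)) (convex_verticalStrip a)
    (fun w hw ↦ integrable_pow_mul_cexp hY h hw) h' (ae_of_all _ fun ω w hw ↦ ?_)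
    (ae_of_all _ fun ω w hw ↦ norm_pow_mul_cexp_le hw _ _) hz
  have := (((hasDerivAt_id w).mul_const (Y ω : ℂ)).cexp.const_mul ((Y ω : ℂ) ^ n))
  refine HasDerivAt.hasDerivWithinAt (this.congr_deriv ?_)
  simp only [id_eq]
  ring

theorem continuousOn_tiltedMoment
    (hY : Measurable Y)
    (hint : ∀ n ≤ 4, Integrable (fun ω ↦ |Y ω| ^ n * (1 + Real.exp (a * Y ω))) P)
    (hne : ∀ z ∈ verticalStrip a, expMoment Y P 0 z ≠ 0)
    {n : ℕ} (hn : n ≤ 4) :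
    ContinuousOn (tiltedMoment Y P n) (verticalStrip a) :=
  (continuousOn_expMoment hY (hint n hn)).div (continuousOn_expMoment hY (hint 0 (by simp))) hne

theorem hasDerivWithinAt_tiltedMoment
    (hY : Measurable Y)
    (hint : ∀ n ≤ 4, Integrable (fun ω ↦ |Y ω| ^ n * (1 + Real.exp (a * Y ω))) P)
    (hne : ∀ z ∈ verticalStrip a, expMoment Y P 0 z ≠ 0)
    {n : ℕ} (hn : n ≤ 3) {z : ℂ} (hz : z ∈ verticalStrip a) :
    HasDerivWithinAt (tiltedMoment Y P n)
      (tiltedMoment Y P (n + 1) z - tiltedMoment Y P n z * tiltedMoment Y P 1 z)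
      (verticalStrip a) z := by
  have h1 := hasDerivWithinAt_expMoment hY (hint n (by omega)) (hint (n + 1) (by omega)) hz
  have h0 := hasDerivWithinAt_expMoment hY (hint 0 (by omega)) (hint 1 (by omega)) hz
  refine (h1.div h0 (hne z hz)).congr_deriv ?_
  have := hne z hz
  simp only [tiltedMoment]
  field_simp

theorem continuousOn_tiltedCumulant
    (hY : Measurable Y)
    (hint : ∀ n ≤ 4, Integrable (fun ω ↦ |Y ω| ^ n * (1 + Real.exp (a * Y ω))) P)
    (hne : ∀ z ∈ verticalStrip a, expMoment Y P 0 z ≠ 0)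
    (n : ℕ) :
    ContinuousOn (tiltedCumulant Y P n) (verticalStrip a) := by
  have h1 := continuousOn_tiltedMoment hY hint hne (n := 1) (by omega)
  have h2 := continuousOn_tiltedMoment hY hint hne (n := 2) (by omega)
  have h3 := continuousOn_tiltedMoment hY hint hne (n := 3) (by omega)
  have h4 := continuousOn_tiltedMoment hY hint hne (n := 4) (by omega)
  match n with
  | 0 => exact continuousOn_const
  | 1 => exact h1
  | 2 => exact h2.sub (h1.pow 2)
  | 3 => exact (h3.sub ((continuousOn_const.mul h1).mul h2)).add (continuousOn_const.mul (h1.pow 3))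
  | 4 =>
    exact (((h4.sub ((continuousOn_const.mul h1).mul h3)).sub (continuousOn_const.mul (h2.pow 2))).add
      ((continuousOn_const.mul (h1.pow 2)).mul h2)).sub (continuousOn_const.mul (h1.pow 4))
  | _ + 5 => exact continuousOn_const

/-- Tilted moments satisfy `m_n' = m_{n+1} - m_n m_1`; each polynomial in `tiltedCumulant` turns
into the next one under this rule. -/
theorem hasDerivWithinAt_tiltedCumulant
    (hY : Measurable Y)
    (hint : ∀ n ≤ 4, Integrable (fun ω ↦ |Y ω| ^ n * (1 + Real.exp (a * Y ω))) P)
    (hne : ∀ z ∈ verticalStrip a, expMoment Y P 0 z ≠ 0)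
    {n : ℕ} (hn : n ∈ Icc 1 3) {z : ℂ}
    (hz : z ∈ verticalStrip a) :
    HasDerivWithinAt (tiltedCumulant Y P n) (tiltedCumulant Y P (n + 1) z) (verticalStrip a) z := by
  have h1 := hasDerivWithinAt_tiltedMoment hY hint hne (n := 1) (by omega) hz
  have h2 := hasDerivWithinAt_tiltedMoment hY hint hne (n := 2) (by omega) hz
  have h3 := hasDerivWithinAt_tiltedMoment hY hint hne (n := 3) (by omega) hz
  obtain ⟨hn1, hn3⟩ := hn
  interval_cases n
  · refine h1.congr_deriv ?_
    simp only [tiltedCumulant]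
    ring
  · refine (h2.sub (h1.pow 2)).congr_deriv ?_
    simp only [tiltedCumulant]
    push_cast
    ring
  · refine ((h3.sub ((h1.const_mul 3).mul h2)).add ((h1.pow 3).const_mul 2)).congr_deriv ?_
    simp only [tiltedCumulant]
    push_cast
    ring

end ExpMoment

/-! ### Boundedness of the higher derivatives on the strip -/

theorem norm_expMoment_le {Ω : Type*} [MeasurableSpace Ω] (Y : Ω → ℝ) (P : Measure Ω) (n : ℕ)
    (z : ℂ) : ‖expMoment Y P n z‖ ≤ ∫ ω, |Y ω| ^ n * Real.exp (z.re * Y ω) ∂P := by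
  refine (norm_integral_le_integral_norm _).trans_eq ?_
  simp only [norm_pow_mul_cexp]

theorem norm_expMoment_ofReal_of_even {Ω : Type*} [MeasurableSpace Ω] (Y : Ω → ℝ) (P : Measure Ω)
    {n : ℕ} (hn : Even n) (u : ℝ) :
    ‖expMoment Y P n u‖ = ∫ ω, |Y ω| ^ n * Real.exp (u * Y ω) ∂P := by
  have h : expMoment Y P n u = ((∫ ω, |Y ω| ^ n * Real.exp (u * Y ω) ∂P : ℝ) : ℂ) := by
    rw [← integral_complex_ofReal]
    simp only [hn.pow_abs]
    simp [expMoment]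
  rw [h, Complex.norm_real, Real.norm_of_nonneg]
  exact integral_nonneg fun ω ↦ by positivity

/-- Absolute moments are themselves values of `expMoment` only for even order, so order three is
controlled by `|x|³ ≤ x² + x⁴`. -/
theorem norm_expMoment_three_le {Ω : Type*} [MeasurableSpace Ω] {Y : Ω → ℝ} {P : Measure Ω}
    {z : ℂ} (hz : z.re ∈ interior (integrableExpSet Y P)) :
    ‖expMoment Y P 3 z‖ ≤ ‖expMoment Y P 2 z.re‖ + ‖expMoment Y P 4 z.re‖ := by
  have hi := fun n ↦ integrable_pow_abs_mul_exp_of_mem_interior_integrableExpSet hz n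
  rw [norm_expMoment_ofReal_of_even _ _ (by decide), norm_expMoment_ofReal_of_even _ _ (by decide),
    ← integral_add (hi 2) (hi 4)]
  refine (norm_expMoment_le _ _ _ _).trans (integral_mono (hi 3) ((hi 2).add (hi 4)) fun ω ↦ ?_)
  simp only [← add_mul]
  gcongr
  nlinarith [sq_nonneg (|Y ω| ^ 2 - |Y ω|), sq_nonneg (|Y ω|), sq_nonneg (|Y ω| ^ 2)]

theorem IsCumulantGenFun.expMoment_zero {Ω : Type*} [MeasurableSpace Ω] {P : Measure Ω}
    {Y : ℝ≥0 → Ω → ℝ} {κ : ℂ → ℂ} (hκ : IsCumulantGenFun Y P κ) {z : ℂ} (hz : z ∈ expDomain Y P)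
    (t : ℝ≥0) : expMoment (Y t) P 0 z = Complex.exp (t * κ z) := by
  rw [← hκ.2 t z hz]
  simp [expMoment]

theorem IsCumulantGenFun.expMoment_zero_ne {Ω : Type*} [MeasurableSpace Ω] {P : Measure Ω}
    {Y : ℝ≥0 → Ω → ℝ} {κ : ℂ → ℂ} (hκ : IsCumulantGenFun Y P κ) {s : Set ℂ}
    (hs : s ⊆ expDomain Y P) : ∀ z ∈ s, expMoment (Y 1) P 0 z ≠ 0 := fun z hz ↦ by
  rw [hκ.expMoment_zero (hs hz)]
  exact Complex.exp_ne_zero _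

namespace IsLevyProcess

variable {Ω : Type*} [MeasurableSpace Ω] {P : Measure Ω} {X : ℝ≥0 → Ω → ℝ}
  {κ : ℂ → ℂ} {a : ℝ}

/-- `κ` is a continuous logarithm of `expMoment (X 1) P 0`, so its derivative is the logarithmic
derivative. -/
theorem hasDerivWithinAt_cumulantGenFun
    (hX : IsLevyProcess X P) (hκ : IsCumulantGenFun X P κ)
    (hstrip : verticalStrip a ⊆ expDomain X P)
    (hint : ∀ n ≤ 4, Integrable (fun ω ↦ |X 1 ω| ^ n * (1 + Real.exp (a * X 1 ω))) P)
    {z : ℂ} (hz : z ∈ verticalStrip a) :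
    HasDerivWithinAt κ (tiltedCumulant (X 1) P 1 z) (verticalStrip a) z :=
  HasDerivWithinAt.of_cexp hz
    (hasDerivWithinAt_expMoment (hX.measurable 1) (hint 0 (by simp)) (hint 1 (by simp)) hz)
    ((hκ.1 z (hstrip hz)).mono hstrip)
    fun w hw ↦ by simp [hκ.expMoment_zero (hstrip hw)]

variable [IsProbabilityMeasure P]

/-- These are the `z`-derivatives of `exp (t κ(z))`. In the open strip all moments of the tilted `X
t` exist automatically, so no moment assumption at times other than `1` is needed. -/
theorem expMoment_eq_of_mem_interior
    (hX : IsLevyProcess X P) (hκ : IsCumulantGenFun X P κ)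
    (hstrip : verticalStrip a ⊆ expDomain X P)
    (hint : ∀ n ≤ 4, Integrable (fun ω ↦ |X 1 ω| ^ n * (1 + Real.exp (a * X 1 ω))) P)
    (t : ℝ≥0) :
    ∀ z ∈ Complex.re ⁻¹' Ioo (min 0 a) (max 0 a),
      expMoment (X t) P 2 z = (t * tiltedCumulant (X 1) P 2 z
        + t ^ 2 * tiltedCumulant (X 1) P 1 z ^ 2) * Complex.exp (t * κ z) ∧
      expMoment (X t) P 3 z = (t * tiltedCumulant (X 1) P 3 z
        + 3 * t ^ 2 * tiltedCumulant (X 1) P 1 z * tiltedCumulant (X 1) P 2 z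
        + t ^ 3 * tiltedCumulant (X 1) P 1 z ^ 3) * Complex.exp (t * κ z) ∧
      expMoment (X t) P 4 z = (t * tiltedCumulant (X 1) P 4 z
        + 4 * t ^ 2 * tiltedCumulant (X 1) P 1 z * tiltedCumulant (X 1) P 3 z
        + 3 * t ^ 2 * tiltedCumulant (X 1) P 2 z ^ 2
        + 6 * t ^ 3 * tiltedCumulant (X 1) P 1 z ^ 2 * tiltedCumulant (X 1) P 2 z
        + t ^ 4 * tiltedCumulant (X 1) P 1 z ^ 4) * Complex.exp (t * κ z) := by
  set U := Complex.re ⁻¹' Ioo (min 0 a) (max 0 a)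
  have hUo : IsOpen U := isOpen_Ioo.preimage Complex.continuous_re
  have hUS : U ⊆ verticalStrip a := fun z hz ↦ Ioo_subset_Icc_self hz
  have hS : ∀ z ∈ U, verticalStrip a ∈ 𝓝 z := fun z hz ↦ mem_of_superset (hUo.mem_nhds hz) hUS
  -- Two derivatives of one function are compared: under the integral sign, and of the closed form
  -- already found.
  have hstep : ∀ (n : ℕ) (f : ℂ → ℂ), (∀ z ∈ U, expMoment (X t) P n z = f z) →
      ∀ z ∈ U, ∀ f', HasDerivAt f f' z → expMoment (X t) P (n + 1) z = f' := by
    intro n f hf z hz f' hf'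
    have hzi : z.re ∈ interior (integrableExpSet (X t) P) := by
      refine interior_maximal (fun u hu ↦ ?_) isOpen_Ioo hz
      have : (u : ℂ) ∈ U := by simpa [U] using hu
      exact hX.integrable_exp_mul (hstrip (hUS this)) t
    refine (hasDerivAt_integral_pow_mul_exp hzi n).unique (hf'.congr_of_eventuallyEq ?_)
    filter_upwards [hUo.mem_nhds hz] with w hw using hf w hw
  have hcum : ∀ n ∈ Icc 1 3, ∀ z ∈ U,
      HasDerivAt (tiltedCumulant (X 1) P n) (tiltedCumulant (X 1) P (n + 1) z) z := fun n hn z hz ↦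
    (hasDerivWithinAt_tiltedCumulant (hX.measurable 1) hint (hκ.expMoment_zero_ne hstrip) hn
      (hUS hz)).hasDerivAt (hS z hz)
  have hexp : ∀ z ∈ U, HasDerivAt (fun w ↦ Complex.exp (t * κ w))
      (Complex.exp (t * κ z) * (t * tiltedCumulant (X 1) P 1 z)) z := fun z hz ↦
    (((hX.hasDerivWithinAt_cumulantGenFun hκ hstrip hint (hUS hz)).hasDerivAt
      (hS z hz)).const_mul (t : ℂ)).cexp
  have h0 : ∀ z ∈ U, expMoment (X t) P 0 z = Complex.exp (t * κ z) := fun z hz ↦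
    hκ.expMoment_zero (hstrip (hUS hz)) t
  have h1 := fun z hz ↦ hstep 0 _ h0 z hz _ (hexp z hz)
  have h2 := fun z hz ↦ hstep 1 _ h1 z hz _
    ((hexp z hz).mul ((hcum 1 (by simp) z hz).const_mul (t : ℂ)))
  have h2' : ∀ z ∈ U, expMoment (X t) P 2 z = (t * tiltedCumulant (X 1) P 2 z
      + t ^ 2 * tiltedCumulant (X 1) P 1 z ^ 2) * Complex.exp (t * κ z) := fun z hz ↦ by
    rw [h2 z hz]
    ring
  have h3 := fun z hz ↦ hstep 2 _ h2' z hz _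
    ((((hcum 2 (by simp) z hz).const_mul (t : ℂ)).add
      (((hcum 1 (by simp) z hz).pow 2).const_mul ((t : ℂ) ^ 2))).mul (hexp z hz))
  have h3' : ∀ z ∈ U, expMoment (X t) P 3 z = (t * tiltedCumulant (X 1) P 3 z
      + 3 * t ^ 2 * tiltedCumulant (X 1) P 1 z * tiltedCumulant (X 1) P 2 z
      + t ^ 3 * tiltedCumulant (X 1) P 1 z ^ 3) * Complex.exp (t * κ z) := fun z hz ↦ by
    rw [h3 z hz]
    simp only [Pi.add_apply, Pi.pow_apply]
    push_cast
    ring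
  have h4 := fun z hz ↦ hstep 3 _ h3' z hz _
    (((((hcum 3 (by simp) z hz).const_mul (t : ℂ)).add
      (((hcum 1 (by simp) z hz).const_mul (3 * (t : ℂ) ^ 2)).mul (hcum 2 (by simp) z hz))).add
      (((hcum 1 (by simp) z hz).pow 3).const_mul ((t : ℂ) ^ 3))).mul (hexp z hz))
  refine fun z hz ↦ ⟨h2' z hz, h3' z hz, ?_⟩
  rw [h4 z hz]
  simp only [Pi.add_apply, Pi.pow_apply, Pi.mul_apply]
  push_cast
  ring

/-- The cumulants are the small-time limits of the rescaled moments of the process. -/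
theorem tendsto_inv_mul_expMoment
    (hX : IsLevyProcess X P) (hκ : IsCumulantGenFun X P κ)
    (hstrip : verticalStrip a ⊆ expDomain X P)
    (hint : ∀ n ≤ 4, Integrable (fun ω ↦ |X 1 ω| ^ n * (1 + Real.exp (a * X 1 ω))) P)
    {z : ℂ} (hz : z ∈ Complex.re ⁻¹' Ioo (min 0 a) (max 0 a))
    {n : ℕ} (hn : n ∈ Icc 2 4) :
    Tendsto (fun t : ℝ≥0 ↦ (t : ℂ)⁻¹ * expMoment (X t) P n z) (𝓝[>] 0)
      (𝓝 (tiltedCumulant (X 1) P n z)) := by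
  have hform := fun t ↦ hX.expMoment_eq_of_mem_interior hκ hstrip hint t z hz
  -- `p` is the moment with one factor `t` removed; at `t = 0` only the coefficient of the linear
  -- term, the cumulant, survives.
  have hlim : ∀ p : ℝ≥0 → ℂ, Continuous p → p 0 = tiltedCumulant (X 1) P n z →
      (∀ t : ℝ≥0, expMoment (X t) P n z = t * p t) →
      Tendsto (fun t : ℝ≥0 ↦ (t : ℂ)⁻¹ * expMoment (X t) P n z) (𝓝[>] 0)
        (𝓝 (tiltedCumulant (X 1) P n z)) := by
    intro p hp h0 hpt
    rw [← h0]
    refine ((hp.tendsto 0).mono_left nhdsWithin_le_nhds).congr' ?_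
    filter_upwards [self_mem_nhdsWithin] with t ht
    have : (t : ℂ) ≠ 0 := by simpa using (ne_of_gt ht : t ≠ 0)
    rw [hpt, inv_mul_cancel_left₀ this]
  have hcoe : Continuous (fun t : ℝ≥0 ↦ (t : ℂ)) :=
    Complex.continuous_ofReal.comp NNReal.continuous_coe
  obtain ⟨hn2, hn4⟩ := hn
  interval_cases n
  · refine hlim (fun t ↦ (tiltedCumulant (X 1) P 2 z
      + t * tiltedCumulant (X 1) P 1 z ^ 2) * Complex.exp (t * κ z)) (by fun_prop) (by simp) ?_
    intro t
    rw [(hform t).1]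
    ring
  · refine hlim (fun t ↦ (tiltedCumulant (X 1) P 3 z
      + 3 * t * tiltedCumulant (X 1) P 1 z * tiltedCumulant (X 1) P 2 z
      + t ^ 2 * tiltedCumulant (X 1) P 1 z ^ 3) * Complex.exp (t * κ z)) (by fun_prop) (by simp) ?_
    intro t
    rw [(hform t).2.1]
    ring
  · refine hlim (fun t ↦ (tiltedCumulant (X 1) P 4 z
      + 4 * t * tiltedCumulant (X 1) P 1 z * tiltedCumulant (X 1) P 3 z
      + 3 * t * tiltedCumulant (X 1) P 2 z ^ 2
      + 6 * t ^ 2 * tiltedCumulant (X 1) P 1 z ^ 2 * tiltedCumulant (X 1) P 2 z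
      + t ^ 3 * tiltedCumulant (X 1) P 1 z ^ 4) * Complex.exp (t * κ z)) (by fun_prop) (by simp) ?_
    intro t
    rw [(hform t).2.2]
    ring

/-- The triangle inequality for the moments of `X t`, divided by `t`, survives the limit `t → 0`.
The bound depends on `z` only through `z.re`. -/
theorem norm_tiltedCumulant_le_of_mem_interior
    (hX : IsLevyProcess X P) (hκ : IsCumulantGenFun X P κ)
    (hstrip : verticalStrip a ⊆ expDomain X P)
    (hint : ∀ n ≤ 4, Integrable (fun ω ↦ |X 1 ω| ^ n * (1 + Real.exp (a * X 1 ω))) P)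
    {z : ℂ}
    (hz : z ∈ Complex.re ⁻¹' Ioo (min 0 a) (max 0 a)) {n : ℕ} (hn : n ∈ Icc 2 4) :
    ‖tiltedCumulant (X 1) P n z‖ ≤
      ‖tiltedCumulant (X 1) P 2 z.re‖ + ‖tiltedCumulant (X 1) P 4 z.re‖ := by
  have hre : (z.re : ℂ) ∈ Complex.re ⁻¹' Ioo (min 0 a) (max 0 a) := hz
  have hlim := fun w hw n hn ↦ (hX.tendsto_inv_mul_expMoment (n := n) (z := w) hκ hstrip hint
    hw hn).norm
  refine le_of_tendsto_of_tendsto (hlim z hz n hn)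
    ((hlim z.re hre 2 (by simp)).add (hlim z.re hre 4 (by simp))) (Eventually.of_forall fun t ↦ ?_)
  simp only [norm_mul, ← mul_add]
  refine mul_le_mul_of_nonneg_left ?_ (norm_nonneg _)
  obtain ⟨hn2, hn4⟩ := hn
  interval_cases n
  · refine (norm_expMoment_le _ _ _ _).trans ?_
    rw [norm_expMoment_ofReal_of_even _ _ (by decide)]
    exact le_add_of_nonneg_right (norm_nonneg _)
  · refine norm_expMoment_three_le (interior_maximal (fun u hu ↦ ?_) isOpen_Ioo hz)
    have : (u : ℂ) ∈ verticalStrip a := Ioo_subset_Icc_self hu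
    exact hX.integrable_exp_mul (hstrip this) t
  · refine (norm_expMoment_le _ _ _ _).trans ?_
    rw [norm_expMoment_ofReal_of_even _ _ (n := 4) (by decide)]
    exact le_add_of_nonneg_left (norm_nonneg _)

/-- The second, third and fourth derivative of the cumulant generating function of a Lévy process
are bounded on closed strips. -/
theorem exists_norm_tiltedCumulant_le
    (hX : IsLevyProcess X P) (hκ : IsCumulantGenFun X P κ)
    (hstrip : verticalStrip a ⊆ expDomain X P)
    (hint : ∀ n ≤ 4, Integrable (fun ω ↦ |X 1 ω| ^ n * (1 + Real.exp (a * X 1 ω))) P)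
    (ha : a ≠ 0) :
    ∃ C, ∀ n ∈ Icc 2 4, ∀ z ∈ verticalStrip a, ‖tiltedCumulant (X 1) P n z‖ ≤ C := by
  have hcont := continuousOn_tiltedCumulant (hX.measurable 1) hint (hκ.expMoment_zero_ne hstrip)
  have hre : ∀ n, ContinuousOn (fun z : ℂ ↦ ‖tiltedCumulant (X 1) P n z.re‖) (verticalStrip a) :=
    fun n ↦ ((hcont n).comp (by fun_prop) fun z hz ↦ by simpa [verticalStrip] using! hz).norm
  have hseg : ∀ n, ∃ C, ∀ u ∈ uIcc 0 a, ‖tiltedCumulant (X 1) P n (u : ℝ)‖ ≤ C := fun n ↦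
    isCompact_uIcc.exists_bound_of_continuousOn
      ((hcont n).comp Complex.continuous_ofReal.continuousOn fun u hu ↦ by
        simpa [verticalStrip] using! hu)
  obtain ⟨C₂, hC₂⟩ := hseg 2
  obtain ⟨C₄, hC₄⟩ := hseg 4
  refine ⟨C₂ + C₄, fun n hn z hz ↦ ?_⟩
  have hcl := closure_preimage_re_Ioo ha
  -- Both sides are continuous on the closed strip, so the inequality passes from the open strip to
  -- its edges.
  have h := le_on_closure (s := Complex.re ⁻¹' Ioo (min 0 a) (max 0 a))
    (f := fun z ↦ ‖tiltedCumulant (X 1) P n z‖)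
    (g := fun z : ℂ ↦ ‖tiltedCumulant (X 1) P 2 z.re‖ + ‖tiltedCumulant (X 1) P 4 z.re‖)
    (fun w hw ↦ hX.norm_tiltedCumulant_le_of_mem_interior hκ hstrip hint hw hn)
    (by rw [hcl]; exact (hcont n).norm) (by rw [hcl]; exact (hre 2).add (hre 4))
    (by rw [hcl]; exact hz)
  exact h.trans (add_le_add (hC₂ _ hz) (hC₄ _ hz))

end IsLevyProcess

/-! ### Taylor remainder and its derivatives in the parameter -/

theorem iteratedDerivWithin_eq_of_hasDerivWithinAt {E : Type*} [NormedAddCommGroup E]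
    [NormedSpace ℝ E] {s : Set ℝ} (hs : UniqueDiffOn ℝ s) {D : ℕ → ℝ → E} {N : ℕ}
    (hD : ∀ n < N, ∀ x ∈ s, HasDerivWithinAt (D n) (D (n + 1) x) s x) :
    ∀ n ≤ N, ∀ x ∈ s, iteratedDerivWithin n (D 0) s x = D n x := by
  intro n
  induction n with
  | zero => simp
  | succ n ih =>
    intro hn x hx
    rw [iteratedDerivWithin_succ, derivWithin_congr (ih (by omega)) (ih (by omega) x hx)]
    exact (hD n (by omega) x hx).derivWithin (hs x hx)

theorem contDiffOn_of_hasDerivWithinAt {E : Type*} [NormedAddCommGroup E]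
    [NormedSpace ℝ E] {s : Set ℝ} (hs : UniqueDiffOn ℝ s) {D : ℕ → ℝ → E} {N : ℕ}
    (hD : ∀ n < N, ∀ x ∈ s, HasDerivWithinAt (D n) (D (n + 1) x) s x)
    (hc : ContinuousOn (D N) s) : ContDiffOn ℝ N (D 0) s := by
  have heq := iteratedDerivWithin_eq_of_hasDerivWithinAt hs hD
  refine contDiffOn_of_continuousOn_differentiableOn_deriv (fun n hn ↦ ?_) fun n hn ↦ ?_
  · have hn' : n ≤ N := by exact_mod_cast hn
    refine ContinuousOn.congr ?_ (heq n hn')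
    rcases hn'.lt_or_eq with h | rfl
    · exact fun x hx ↦ (hD n h x hx).continuousWithinAt
    · exact hc
  · have hn' : n < N := by exact_mod_cast hn
    exact fun x hx ↦ ((hD n hn' x hx).congr (heq n hn'.le)
      (heq n hn'.le x hx)).differentiableWithinAt

noncomputable section

/-- The integral form of the remainder of the Taylor expansion of first order at `0`, where `K`
is the sequence of derivatives, together with its derivatives in the direction of the argument. -/
def taylorRemainder (K : ℕ → ℂ → ℂ) (n : ℕ) (l : ℝ) (z : ℂ) : ℂ :=
  ∫ s in (0 : ℝ)..1, (1 - s) * s ^ n * K (n + 2) (((s * l : ℝ) : ℂ) * z)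

/-- The `n`-th derivative in `l` of `m z + l⁻² (k (l z) - m l z)`, in terms of the derivatives `K`
of `k`. -/
def scaledDeriv (K : ℕ → ℂ → ℂ) (m : ℂ) (n : ℕ) (l : ℝ) (z : ℂ) : ℂ :=
  (if n = 0 then m * z else 0) + z ^ (n + 2) * taylorRemainder K n l z

end

section Taylor

variable {a : ℝ} {k : ℂ → ℂ} {K : ℕ → ℂ → ℂ}

theorem hasDerivWithinAt_comp_ofReal_mul {f : ℂ → ℂ} {f' z : ℂ} {c l : ℝ}
    (hc : c ∈ Icc (0 : ℝ) 1) (hz : z ∈ verticalStrip a)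
    (hf : HasDerivWithinAt f f' (verticalStrip a) (((c * l : ℝ) : ℂ) * z)) :
    HasDerivWithinAt (fun l : ℝ ↦ f (((c * l : ℝ) : ℂ) * z)) (c * z * f') (Icc 0 1) l := by
  have h1 : HasDerivAt (fun l : ℝ ↦ ((c * l : ℝ) : ℂ) * z) (c * z) l := by
    have := ((((hasDerivAt_id l).const_mul c).ofReal_comp).mul_const z)
    simpa using this
  exact hf.scomp l h1.hasDerivWithinAt fun r hr ↦
    smul_mem_verticalStrip hz ⟨mul_nonneg hc.1 hr.1, mul_le_one₀ hc.2 hr.1 hr.2⟩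

theorem norm_weight_mul_le {s : ℝ} (hs : s ∈ Icc (0 : ℝ) 1) (n : ℕ) (w : ℂ) :
    ‖(1 - (s : ℂ)) * (s : ℂ) ^ n * w‖ ≤ ‖w‖ := by
  have h1 : ‖(1 - (s : ℂ))‖ ≤ 1 := by
    rw [← Complex.ofReal_one, ← Complex.ofReal_sub, Complex.norm_real, Real.norm_eq_abs, abs_le]
    constructor <;> linarith [hs.1, hs.2]
  have h2 : ‖(s : ℂ) ^ n‖ ≤ 1 := by
    rw [norm_pow, Complex.norm_real, Real.norm_of_nonneg hs.1]
    exact pow_le_one₀ hs.1 hs.2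
  rw [norm_mul, norm_mul]
  exact mul_le_of_le_one_left (norm_nonneg _) (mul_le_one₀ h1 (norm_nonneg _) h2)

theorem mul_ofReal_mem_verticalStrip {z : ℂ} (hz : z ∈ verticalStrip a) {s l : ℝ}
    (hs : s ∈ Icc (0 : ℝ) 1) (hl : l ∈ Icc (0 : ℝ) 1) : ((s * l : ℝ) : ℂ) * z ∈ verticalStrip a :=
  smul_mem_verticalStrip hz ⟨mul_nonneg hs.1 hl.1, mul_le_one₀ hs.2 hl.1 hl.2⟩

theorem continuousOn_weight_mul {n : ℕ} (hK : ContinuousOn (K (n + 2)) (verticalStrip a))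
    {z : ℂ} (hz : z ∈ verticalStrip a) {l : ℝ} (hl : l ∈ Icc (0 : ℝ) 1) :
    ContinuousOn (fun s : ℝ ↦ (1 - (s : ℂ)) * (s : ℂ) ^ n * K (n + 2) (((s * l : ℝ) : ℂ) * z))
      (Icc 0 1) :=
  ContinuousOn.mul (by fun_prop) (hK.comp (by fun_prop) fun _ hs ↦
    mul_ofReal_mem_verticalStrip hz hs hl)

theorem eq_add_mul_taylorRemainder (hk : ∀ z ∈ verticalStrip a,
      HasDerivWithinAt k (K 1 z) (verticalStrip a) z)
    (hK1 : ∀ z ∈ verticalStrip a, HasDerivWithinAt (K 1) (K 2 z) (verticalStrip a) z)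
    (hK2 : ContinuousOn (K 2) (verticalStrip a)) {z : ℂ} (hz : z ∈ verticalStrip a) {l : ℝ}
    (hl : l ∈ Icc (0 : ℝ) 1) :
    k (l * z) = k 0 + K 1 0 * (l * z) + (l * z) ^ 2 * taylorRemainder K 0 l z := by
  have hlz : (l : ℂ) * z ∈ verticalStrip a := smul_mem_verticalStrip hz hl
  set w := (l : ℂ) * z with hw
  have one_mem : (1 : ℝ) ∈ Icc (0 : ℝ) 1 := ⟨zero_le_one, le_rfl⟩
  have hmem : ∀ s ∈ Icc (0 : ℝ) 1, ((1 * s : ℝ) : ℂ) * w ∈ verticalStrip a := fun s hs ↦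
    mul_ofReal_mem_verticalStrip hlz one_mem hs
  -- This antiderivative carries out the integration by parts in advance. The form `1 * s` matches
  -- `hasDerivWithinAt_comp_ofReal_mul` with `c = 1`.
  have hG : ∀ s ∈ Icc (0 : ℝ) 1, HasDerivWithinAt (fun s : ℝ ↦
      (1 - (s : ℂ)) * (w * K 1 (((1 * s : ℝ) : ℂ) * w)) + k (((1 * s : ℝ) : ℂ) * w))
      ((1 - (s : ℂ)) * (w ^ 2 * K 2 (((1 * s : ℝ) : ℂ) * w))) (Icc 0 1) s := by
    intro s hs
    have h1 := hasDerivWithinAt_comp_ofReal_mul one_mem hlz (hk _ (hmem s hs))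
    have h2 := hasDerivWithinAt_comp_ofReal_mul one_mem hlz (hK1 _ (hmem s hs))
    have h3 : HasDerivWithinAt (fun s : ℝ ↦ 1 - (s : ℂ)) (-1) (Icc 0 1) s :=
      (Complex.ofRealCLM.hasDerivAt (x := s)).hasDerivWithinAt.const_sub 1
    refine ((h3.mul (h2.const_mul w)).add h1).congr_deriv ?_
    push_cast
    ring
  have hint := intervalIntegral.integral_eq_sub_of_hasDeriv_right_of_le zero_le_one
    (fun s hs ↦ (hG s hs).continuousWithinAt)
    (fun s hs ↦ ((hG s (Ioo_subset_Icc_self hs)).hasDerivAt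
      (Icc_mem_nhds hs.1 hs.2)).hasDerivWithinAt)
    (ContinuousOn.intervalIntegrable (by
      rw [uIcc_of_le zero_le_one]
      exact ContinuousOn.mul (by fun_prop) (continuousOn_const.mul
        (hK2.comp (by fun_prop) hmem))))
  have hR : taylorRemainder K 0 l z =
      ∫ s in (0 : ℝ)..1, (1 - (s : ℂ)) * K 2 (((1 * s : ℝ) : ℂ) * w) := by
    refine intervalIntegral.integral_congr fun s _ ↦ ?_
    simp only [pow_zero, mul_one, one_mul, hw]
    push_cast
    rw [mul_assoc]
  have hpull : ∫ s in (0 : ℝ)..1, (1 - (s : ℂ)) * (w ^ 2 * K 2 (((1 * s : ℝ) : ℂ) * w)) =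
      w ^ 2 * taylorRemainder K 0 l z := by
    rw [hR, ← intervalIntegral.integral_const_mul]
    congr with s
    ring
  rw [hpull] at hint
  simp only [mul_one, mul_zero, Complex.ofReal_one, Complex.ofReal_zero, sub_self, zero_mul,
    one_mul, sub_zero, zero_add] at hint
  rw [hint]
  ring

theorem hasDerivWithinAt_taylorRemainder {n : ℕ}
    (hK : ∀ z ∈ verticalStrip a,
      HasDerivWithinAt (K (n + 2)) (K (n + 3) z) (verticalStrip a) z) {C : ℝ}
    (hC : ∀ z ∈ verticalStrip a, ‖K (n + 3) z‖ ≤ C) {z : ℂ} (hz : z ∈ verticalStrip a) {l : ℝ}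
    (hl : l ∈ Icc (0 : ℝ) 1) :
    HasDerivWithinAt (fun l ↦ taylorRemainder K n l z) (z * taylorRemainder K (n + 1) l z)
      (Icc 0 1) l := by
  have hKc : ContinuousOn (K (n + 2)) (verticalStrip a) := fun w hw ↦ (hK w hw).continuousWithinAt
  have hz' : z * taylorRemainder K (n + 1) l z = ∫ s in Ioc (0 : ℝ) 1,
      z * ((1 - (s : ℂ)) * (s : ℂ) ^ (n + 1) * K (n + 3) (((s * l : ℝ) : ℂ) * z)) := by
    rw [taylorRemainder, intervalIntegral.integral_of_le zero_le_one, integral_const_mul]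
  rw [hz']
  simp only [taylorRemainder, intervalIntegral.integral_of_le zero_le_one]
  have hIoc : ∀ᵐ s ∂(volume.restrict (Ioc (0 : ℝ) 1)), s ∈ Icc (0 : ℝ) 1 :=
    (ae_restrict_mem measurableSet_Ioc).mono fun s hs ↦ Ioc_subset_Icc_self hs
  refine hasDerivWithinAt_integral_of_dominated_of_convex
    (F' := fun (l s : ℝ) ↦ z * ((1 - (s : ℂ)) * (s : ℂ) ^ (n + 1) * K (n + 3) (((s * l : ℝ) : ℂ) * z)))
    (convex_Icc 0 1) (bound := fun _ ↦ ‖z‖ * C) (fun x hx ↦ ?_) (integrable_const _)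
    (hIoc.mono fun s hs x hx ↦ ?_) (hIoc.mono fun s hs x hx ↦ ?_) hl
  · exact ((continuousOn_weight_mul hKc hz hx).integrableOn_compact isCompact_Icc).mono_set
      Ioc_subset_Icc_self
  · refine ((hasDerivWithinAt_comp_ofReal_mul hs hz
      (hK _ (mul_ofReal_mem_verticalStrip hz hs hx))).const_mul
        ((1 - (s : ℂ)) * (s : ℂ) ^ n)).congr_deriv ?_
    ring
  · rw [norm_mul]
    exact mul_le_mul_of_nonneg_left ((norm_weight_mul_le hs _ _).trans
      (hC _ (mul_ofReal_mem_verticalStrip hz hs hx))) (norm_nonneg _)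

theorem continuousOn_taylorRemainder {n : ℕ} (hK : ContinuousOn (K (n + 2)) (verticalStrip a))
    {C : ℝ} (hC : ∀ z ∈ verticalStrip a, ‖K (n + 2) z‖ ≤ C) :
    ContinuousOn (fun p : ℝ × ℂ ↦ taylorRemainder K n p.1 p.2) (Icc 0 1 ×ˢ verticalStrip a) := by
  rintro ⟨l, z⟩ hp
  have hIoc : ∀ s ∈ uIoc (0 : ℝ) 1, s ∈ Icc (0 : ℝ) 1 := fun s hs ↦
    Ioc_subset_Icc_self (by rwa [uIoc_of_le zero_le_one] at hs)
  refine intervalIntegral.continuousWithinAt_of_dominated_interval (bound := fun _ ↦ C) ?_ ?_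
    intervalIntegrable_const (ae_of_all _ fun s hs ↦ ?_)
  · filter_upwards [self_mem_nhdsWithin] with q hq
    rw [uIoc_of_le zero_le_one]
    exact ((continuousOn_weight_mul hK hq.2 hq.1).mono
      Ioc_subset_Icc_self).aestronglyMeasurable measurableSet_Ioc
  · filter_upwards [self_mem_nhdsWithin] with q hq
    exact ae_of_all _ fun s hs ↦ (norm_weight_mul_le (hIoc s hs) _ _).trans
      (hC _ (mul_ofReal_mem_verticalStrip hq.2 (hIoc s hs) hq.1))
  · have : ContinuousOn (fun q : ℝ × ℂ ↦ (1 - (s : ℂ)) * (s : ℂ) ^ n *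
        K (n + 2) (((s * q.1 : ℝ) : ℂ) * q.2)) (Icc 0 1 ×ˢ verticalStrip a) :=
      continuousOn_const.mul (hK.comp (by fun_prop) fun q hq ↦
        mul_ofReal_mem_verticalStrip hq.2 (hIoc s hs) hq.1)
    exact this _ hp

theorem norm_taylorRemainder_le {n : ℕ} {C : ℝ} (hC : ∀ z ∈ verticalStrip a, ‖K (n + 2) z‖ ≤ C)
    {z : ℂ} (hz : z ∈ verticalStrip a) {l : ℝ} (hl : l ∈ Icc (0 : ℝ) 1) :
    ‖taylorRemainder K n l z‖ ≤ C := by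
  have h := intervalIntegral.norm_integral_le_of_norm_le_const (a := (0 : ℝ)) (b := 1) (C := C)
    (f := fun s : ℝ ↦ (1 - (s : ℂ)) * (s : ℂ) ^ n * K (n + 2) (((s * l : ℝ) : ℂ) * z))
    (fun s hs ↦ by
      rw [uIoc_of_le zero_le_one] at hs
      exact (norm_weight_mul_le (Ioc_subset_Icc_self hs) _ _).trans
        (hC _ (mul_ofReal_mem_verticalStrip hz (Ioc_subset_Icc_self hs) hl)))
  simpa [taylorRemainder] using h

/-- At `l = 0` only the weight is integrated; for `n = 0, 1, 2` it yields the coefficients `1/2`,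
`1/6`, `1/12`. -/
theorem taylorRemainder_zero_right (n : ℕ) (z : ℂ) :
    taylorRemainder K n 0 z = (1 / (n + 1) - 1 / (n + 2)) * K (n + 2) 0 := by
  have h : ∫ s in (0 : ℝ)..1, (1 - (s : ℂ)) * (s : ℂ) ^ n =
      (((1 / (n + 1) - 1 / (n + 2) : ℝ)) : ℂ) := by
    have : ∀ s : ℝ, (1 - (s : ℂ)) * (s : ℂ) ^ n = ((s ^ n - s ^ (n + 1) : ℝ) : ℂ) := fun s ↦ by
      push_cast
      ring
    simp only [this]
    rw [intervalIntegral.integral_ofReal, intervalIntegral.integral_sub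
      (Continuous.intervalIntegrable (by fun_prop) _ _)
      (Continuous.intervalIntegrable (by fun_prop) _ _), integral_pow, integral_pow]
    congr 1
    push_cast
    norm_num
    ring
  simp only [taylorRemainder, mul_zero, Complex.ofReal_zero, zero_mul]
  rw [intervalIntegral.integral_mul_const, h]
  push_cast
  rfl

theorem hasDerivWithinAt_scaledDeriv {n : ℕ} (m : ℂ)
    (hK : ∀ z ∈ verticalStrip a,
      HasDerivWithinAt (K (n + 2)) (K (n + 3) z) (verticalStrip a) z) {C : ℝ}
    (hC : ∀ z ∈ verticalStrip a, ‖K (n + 3) z‖ ≤ C) {z : ℂ} (hz : z ∈ verticalStrip a) {l : ℝ}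
    (hl : l ∈ Icc (0 : ℝ) 1) :
    HasDerivWithinAt (fun l ↦ scaledDeriv K m n l z) (scaledDeriv K m (n + 1) l z) (Icc 0 1) l := by
  refine (((hasDerivWithinAt_taylorRemainder hK hC hz hl).const_mul (z ^ (n + 2))).const_add
    (if n = 0 then m * z else 0)).congr_deriv ?_
  simp only [scaledDeriv, Nat.add_eq_zero_iff, one_ne_zero, and_false, if_false]
  ring

theorem continuousOn_scaledDeriv {n : ℕ} (m : ℂ) (hK : ContinuousOn (K (n + 2)) (verticalStrip a))
    {C : ℝ} (hC : ∀ z ∈ verticalStrip a, ‖K (n + 2) z‖ ≤ C) :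
    ContinuousOn (fun p : ℝ × ℂ ↦ scaledDeriv K m n p.1 p.2) (Icc 0 1 ×ˢ verticalStrip a) := by
  refine ContinuousOn.add ?_ (ContinuousOn.mul (by fun_prop) (continuousOn_taylorRemainder hK hC))
  split_ifs <;> fun_prop

theorem norm_scaledDeriv_le {n : ℕ} (m : ℂ) {C : ℝ}
    (hC : ∀ z ∈ verticalStrip a, ‖K (n + 2) z‖ ≤ C) {z : ℂ} (hz : z ∈ verticalStrip a) {l : ℝ}
    (hl : l ∈ Icc (0 : ℝ) 1) :
    ‖scaledDeriv K m n l z‖ ≤ (‖m‖ + C) * (1 + ‖z‖ ^ (3 + n)) := by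
  -- The powers that occur are `1` and `n + 2`, both at most `3 + n`.
  have hpow : ∀ j ≤ 3 + n, ‖z‖ ^ j ≤ 1 + ‖z‖ ^ (3 + n) := by
    intro j hj
    rcases le_total ‖z‖ 1 with h | h
    · exact (pow_le_one₀ (norm_nonneg _) h).trans (le_add_of_nonneg_right (by positivity))
    · exact (pow_le_pow_right₀ h hj).trans (le_add_of_nonneg_left zero_le_one)
  have hC0 : 0 ≤ C := (norm_nonneg _).trans (norm_taylorRemainder_le hC hz hl)
  have h1 : ‖(if n = 0 then m * z else 0)‖ ≤ ‖m‖ * (1 + ‖z‖ ^ (3 + n)) := by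
    split_ifs
    · rw [norm_mul]
      simpa using mul_le_mul_of_nonneg_left (hpow 1 (by omega)) (norm_nonneg m)
    · rw [norm_zero]
      positivity
  have h2 : ‖z ^ (n + 2) * taylorRemainder K n l z‖ ≤ C * (1 + ‖z‖ ^ (3 + n)) := by
    rw [norm_mul, norm_pow, mul_comm]
    exact mul_le_mul (norm_taylorRemainder_le hC hz hl) (hpow (n + 2) (by omega)) (by positivity)
      hC0
  rw [add_mul]
  exact (norm_add_le _ _).trans (add_le_add h1 h2)

end Taylor

/-! ### Cumulant generating functions along the curve of processes -/

theorem IsCumulantGenFun.cumulantGenFun {Ω : Type*} [MeasurableSpace Ω] {Y : ℝ≥0 → Ω → ℝ}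
    {P : Measure Ω} {κ : ℂ → ℂ} (h : IsCumulantGenFun Y P κ) :
    IsCumulantGenFun Y P (cumulantGenFun Y P) := by
  have hex : ∃ κ, IsCumulantGenFun Y P κ := ⟨κ, h⟩
  rw [_root_.cumulantGenFun, dif_pos hex]
  exact hex.choose_spec

theorem IsCumulantGenFun.map_zero {Ω : Type*} [MeasurableSpace Ω] {Y : ℝ≥0 → Ω → ℝ}
    {P : Measure Ω} [IsProbabilityMeasure P] {κ : ℂ → ℂ} (h : IsCumulantGenFun Y P κ) :
    κ 0 = 0 := by
  have h0 : (0 : ℂ) ∈ expDomain Y P := by simp [expDomain]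
  refine Complex.eq_of_forall_exp_mul_eq fun t ↦ ?_
  rw [← h.2 t 0 h0]
  simp

theorem expDomain_driftedProcess {Ω' : Type*} [MeasurableSpace Ω'] {P' : Measure Ω'}
    {W : ℝ≥0 → Ω' → ℝ} (hW : IsBrownianReal W P') (μ σ : ℝ) :
    expDomain (driftedProcess μ σ W) P' = univ := by
  refine eq_univ_of_forall fun z ↦ ?_
  have hlaw := hW.hasLaw_eval 1
  have h : Integrable (fun ω ↦ Real.exp (z.re * σ * W 1 ω)) P' := by
    have := integrable_exp_mul_gaussianReal (μ := 0) (v := 1) (z.re * σ)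
    rw [← hlaw.map_eq] at this
    exact this.comp_aemeasurable hlaw.aemeasurable
  refine (h.const_mul (Real.exp (z.re * μ))).congr (ae_of_all _ fun ω ↦ ?_)
  simp only [driftedProcess, NNReal.coe_one, mul_one]
  rw [← Real.exp_add]
  ring_nf

theorem isCumulantGenFun_driftedProcess {Ω' : Type*} [MeasurableSpace Ω'] {P' : Measure Ω'}
    {W : ℝ≥0 → Ω' → ℝ} (hW : IsBrownianReal W P') (μ σ : ℝ) :
    IsCumulantGenFun (driftedProcess μ σ W) P' (fun z ↦ μ * z + 1 / 2 * σ ^ 2 * z ^ 2) := by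
  refine ⟨by fun_prop, fun t z _ ↦ ?_⟩
  have h : ∀ ω, Complex.exp (z * (driftedProcess μ σ W t ω : ℝ)) =
      Complex.exp (t * (μ * z)) * Complex.exp (z * σ * W t ω) := fun ω ↦ by
    rw [← Complex.exp_add, driftedProcess]
    push_cast
    ring_nf
  have hmgf := complexMGF_gaussianReal (hW.hasLaw_eval t).map_eq (z * σ)
  simp only [h]
  rw [complexMGF] at hmgf
  rw [integral_const_mul, hmgf, ← Complex.exp_add]
  congr 1
  push_cast
  ring

namespace IsLevyProcess

variable {Ω : Type*} [MeasurableSpace Ω] {P : Measure Ω} {X : ℝ≥0 → Ω → ℝ} [IsProbabilityMeasure P]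

/-- At time `1` the scaled process involves `X` at time `1 / l² ≥ 1`, where the exponential domain
is the same as at time `1`. -/
theorem mem_expDomain_scaledProcess_iff (hX : IsLevyProcess X P) {l : ℝ} (hl : l ∈ Ioc (0 : ℝ) 1)
    {z : ℂ} : z ∈ expDomain (scaledProcess X P l) P ↔ (l : ℂ) * z ∈ expDomain X P := by
  have h1 : 1 ≤ 1 / l.toNNReal ^ 2 := by
    have hpos : 0 < l.toNNReal := Real.toNNReal_pos.2 hl.1
    rw [one_le_div (by positivity)]
    exact pow_le_one₀ zero_le (Real.toNNReal_le_one.2 hl.2)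
  have h2 := hX.integrableExpSet_eq h1
  have h3 : (l : ℂ) * z ∈ expDomain X P ↔ l * z.re ∈ integrableExpSet (X (1 / l.toNNReal ^ 2)) P := by
    rw [h2, expDomain_eq_preimage, mem_preimage, Complex.re_ofReal_mul]
  rw [h3]
  have h4 : ∀ ω, Real.exp (z.re * scaledProcess X P l 1 ω) =
      Real.exp (z.re * ((1 - 1 / l) * ∫ ω', X 1 ω' ∂P)) *
        Real.exp (l * z.re * X (1 / l.toNNReal ^ 2) ω) := fun ω ↦ by
    rw [← Real.exp_add, scaledProcess, NNReal.coe_one]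
    ring_nf
  change Integrable (fun ω ↦ Real.exp (z.re * scaledProcess X P l 1 ω)) P ↔ _
  simp only [h4]
  exact integrable_const_mul_iff (Real.exp_pos _).ne'.isUnit _

theorem isCumulantGenFun_scaledProcess (hX : IsLevyProcess X P) {κ : ℂ → ℂ}
    (hκ : IsCumulantGenFun X P κ) {l : ℝ} (hl : l ∈ Ioc (0 : ℝ) 1) :
    IsCumulantGenFun (scaledProcess X P l) P
      (fun z ↦ (1 - 1 / l) * (∫ ω, X 1 ω ∂P : ℝ) * z + κ (l * z) / l ^ 2) := by
  have hmem := fun z ↦ hX.mem_expDomain_scaledProcess_iff hl (z := z)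
  refine ⟨ContinuousOn.add (by fun_prop) (ContinuousOn.div_const
    (hκ.1.comp (by fun_prop) fun z hz ↦ (hmem z).1 hz) _), fun t z hz ↦ ?_⟩
  have h : ∀ ω, Complex.exp (z * (scaledProcess X P l t ω : ℝ)) =
      Complex.exp (t * ((1 - 1 / l) * (∫ ω, X 1 ω ∂P : ℝ) * z)) *
        Complex.exp (l * z * X (t / l.toNNReal ^ 2) ω) := fun ω ↦ by
    rw [← Complex.exp_add, scaledProcess]
    push_cast
    ring_nf
  simp only [h]
  rw [integral_const_mul, hκ.2 _ _ ((hmem z).1 hz), ← Complex.exp_add]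
  congr 1
  have : ((t / l.toNNReal ^ 2 : ℝ≥0) : ℂ) = t / l ^ 2 := by
    rw [← Complex.ofReal_pow, ← Complex.ofReal_div]
    congr 1
    push_cast
    rw [Real.coe_toNNReal l hl.1.le]
  rw [this]
  ring

end IsLevyProcess

/-! ### Cumulants at the origin as central moments -/

section Values

variable {Ω : Type*} [MeasurableSpace Ω] {P : Measure Ω} [IsProbabilityMeasure P] {Y : Ω → ℝ}

theorem tiltedMoment_zero (n : ℕ) : tiltedMoment Y P n 0 = ((∫ ω, Y ω ^ n ∂P : ℝ) : ℂ) := by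
  rw [← integral_complex_ofReal]
  simp [tiltedMoment, expMoment]

theorem tiltedCumulant_one_zero : tiltedCumulant Y P 1 0 = ((∫ ω, Y ω ∂P : ℝ) : ℂ) := by
  simp [tiltedCumulant, tiltedMoment_zero]

theorem tiltedCumulant_two_zero (h : MemLp Y 2 P) :
    tiltedCumulant Y P 2 0 = (variance Y P : ℝ) := by
  rw [variance_eq_sub h]
  simp [tiltedCumulant, tiltedMoment_zero]

theorem tiltedCumulant_three_zero (h : ∀ n ≤ 3, Integrable (fun ω ↦ Y ω ^ n) P) :
    tiltedCumulant Y P 3 0 = ((∫ ω, (Y ω - ∫ ω', Y ω' ∂P) ^ 3 ∂P : ℝ) : ℂ) := by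
  set m := ∫ ω', Y ω' ∂P with hm
  have e : ∀ ω, (Y ω - m) ^ 3 = Y ω ^ 3 + -3 * m * Y ω ^ 2 + 3 * m ^ 2 * Y ω ^ 1 + -m ^ 3 :=
    fun ω ↦ by ring
  have i1 := (h 1 (by simp)).const_mul (3 * m ^ 2)
  have i2 := (h 2 (by simp)).const_mul (-3 * m)
  have i3 := h 3 (by simp)
  simp only [e]
  rw [integral_add ((i3.fun_add i2).fun_add i1) (integrable_const _),
    integral_add (i3.fun_add i2) i1,
    integral_add i3 i2, integral_const_mul, integral_const_mul]
  simp only [tiltedCumulant, tiltedMoment_zero, pow_one, ← hm, integral_const, probReal_univ,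
    one_smul]
  push_cast
  ring

theorem tiltedCumulant_four_zero (h : ∀ n ≤ 4, Integrable (fun ω ↦ Y ω ^ n) P) (h2 : MemLp Y 2 P) :
    tiltedCumulant Y P 4 0 =
      ((∫ ω, (Y ω - ∫ ω', Y ω' ∂P) ^ 4 ∂P) - 3 * variance Y P ^ 2 : ℝ) := by
  rw [variance_eq_sub h2]
  set m := ∫ ω', Y ω' ∂P with hm
  have e : ∀ ω, (Y ω - m) ^ 4 = Y ω ^ 4 + -4 * m * Y ω ^ 3 + 6 * m ^ 2 * Y ω ^ 2
      + -4 * m ^ 3 * Y ω ^ 1 + m ^ 4 := fun ω ↦ by ring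
  have i1 := (h 1 (by simp)).const_mul (-4 * m ^ 3)
  have i2 := (h 2 (by simp)).const_mul (6 * m ^ 2)
  have i3 := (h 3 (by simp)).const_mul (-4 * m)
  have i4 := h 4 (by simp)
  simp only [e]
  rw [integral_add (((i4.fun_add i3).fun_add i2).fun_add i1) (integrable_const _),
    integral_add ((i4.fun_add i3).fun_add i2) i1, integral_add (i4.fun_add i3) i2, integral_add i4 i3,
    integral_const_mul, integral_const_mul, integral_const_mul]
  simp only [tiltedCumulant, tiltedMoment_zero, pow_one, ← hm, integral_const, probReal_univ,
    one_smul, Pi.pow_apply]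
  push_cast
  ring

end Values

/-! ### Assembly -/

theorem verticalLines_subset_verticalStrip (R : ℝ) : verticalLines R ⊆ verticalStrip (2 * R) := by
  intro z hz
  rcases hz with h | h | h
  · simp [verticalStrip, h]
  · rw [verticalStrip, mem_preimage, h, mem_uIcc]
    rcases le_total 0 R with h | h
    · left; constructor <;> linarith
    · right; constructor <;> linarith
  · rw [mem_singleton_iff] at h
    simp [verticalStrip, h]

/-- The two edges of the strip are treated differently: interiority of `a` absorbs the polynomial
factor there, while at `0`, possibly a boundary point, the moment is assumed. -/
theorem integrable_pow_abs_mul_one_add_exp {Ω : Type*} [MeasurableSpace Ω] {P : Measure Ω}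
    {Y : Ω → ℝ} {a : ℝ} (ha : a ∈ interior (integrableExpSet Y P)) {n : ℕ}
    (h : Integrable (fun ω ↦ |Y ω| ^ n) P) :
    Integrable (fun ω ↦ |Y ω| ^ n * (1 + Real.exp (a * Y ω))) P := by
  simpa [mul_add] using! h.add (integrable_pow_abs_mul_exp_of_mem_interior_integrableExpSet ha n)

theorem proposition4p9 {Ω Ω' : Type*} [MeasurableSpace Ω] [MeasurableSpace Ω']
    (P : Measure Ω) [IsProbabilityMeasure P] (P' : Measure Ω') [IsProbabilityMeasure P']
    (X : ℝ≥0 → Ω → ℝ) (hX : IsLevyProcess X P)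
    (W : ℝ≥0 → Ω' → ℝ) (hW : IsBrownianReal W P')
    (hexp : Integrable (fun ω ↦ Real.exp (2 * X 1 ω)) P)
    (hmom : ∀ n ∈ Finset.Icc 1 5, Integrable (fun ω ↦ |X 1 ω| ^ n) P)
    (hvar : 0 < variance (X 1) P)
    (R : ℝ) (hR : R ≠ 0) (hRD : ((2 * R : ℝ) : ℂ) ∈ interior (expDomain X P))
    (μ σ : ℝ) (hμ : μ = ∫ ω, X 1 ω ∂P) (hσ : σ = √(variance (X 1) P))
    (κ : ℝ → ℂ → ℂ) (hκ : κ = kappaFamily X P W P') :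
    -- the cumulant generating functions exist, and the three lines lie in their domains
    (IsCumulantGenFun (driftedProcess μ σ W) P' (κ 0) ∧
      verticalLines R ⊆ expDomain (driftedProcess μ σ W) P') ∧
    (∀ l ∈ Ioc (0 : ℝ) 1, IsCumulantGenFun (scaledProcess X P l) P (κ l) ∧
      verticalLines R ⊆ expDomain (scaledProcess X P l) P) ∧
    -- twice differentiable in the parameter, with jointly continuous derivatives
    (∀ z ∈ verticalLines R, ContDiffOn ℝ 2 (fun l ↦ κ l z) (Icc 0 1)) ∧
    (∀ n ≤ 2, ContinuousOn
      (fun p : ℝ × ℂ ↦ iteratedDerivWithin n (fun l ↦ κ l p.2) (Icc 0 1) p.1)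
      (Icc 0 1 ×ˢ verticalLines R)) ∧
    -- the values at `l = 0`
    (∀ z ∈ verticalLines R,
      κ 0 z = μ * z + 1 / 2 * σ ^ 2 * z ^ 2 ∧
      iteratedDerivWithin 1 (fun l ↦ κ l z) (Icc 0 1) 0 =
        1 / 6 * ((∫ ω, (X 1 ω - μ) ^ 3 ∂P : ℝ) : ℂ) * z ^ 3 ∧
      iteratedDerivWithin 2 (fun l ↦ κ l z) (Icc 0 1) 0 =
        1 / 12 * (((∫ ω, (X 1 ω - μ) ^ 4 ∂P) - 3 * σ ^ 4 : ℝ) : ℂ) * z ^ 4) ∧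
    -- the growth estimates
    (∃ c₁ : ℝ, 0 < c₁ ∧ ∀ n ≤ 2, ∀ l ∈ Icc (0 : ℝ) 1, ∀ z ∈ verticalLines R,
      ‖iteratedDerivWithin n (fun l' ↦ κ l' z) (Icc 0 1) l‖ ≤ c₁ * (1 + ‖z‖ ^ (3 + n))) := by
  have hM := hX.measurable 1
  have ha : 2 * R ≠ 0 := mul_ne_zero two_ne_zero hR
  have hRD' : 2 * R ∈ interior (integrableExpSet (X 1) P) := by
    rw [expDomain_eq_preimage, Complex.interior_preimage_re] at hRD
    exact hRD
  have habs : ∀ n ≤ 4, Integrable (fun ω ↦ |X 1 ω| ^ n) P := by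
    intro n hn
    rcases Nat.eq_zero_or_pos n with rfl | h
    · simp
    · exact hmom n (Finset.mem_Icc.2 ⟨h, by omega⟩)
  have hpow : ∀ n ≤ 4, Integrable (fun ω ↦ X 1 ω ^ n) P := fun n hn ↦
    (habs n hn).mono' (hM.pow_const n).aestronglyMeasurable
      (ae_of_all _ fun ω ↦ by simp)
  have hL2 : MemLp (X 1) 2 P :=
    (memLp_two_iff_integrable_sq hM.aestronglyMeasurable).2 (hpow 2 (by simp))
  have hint : ∀ n ≤ 4,
      Integrable (fun ω ↦ |X 1 ω| ^ n * (1 + Real.exp (2 * R * X 1 ω))) P := fun n hn ↦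
    integrable_pow_abs_mul_one_add_exp hRD' (habs n hn)
  have hstrip : verticalStrip (2 * R) ⊆ expDomain X P := by
    rw [expDomain_eq_preimage]
    -- The real exponential domain is an interval containing `0` and `2 * R`.
    refine preimage_mono (convex_integrableExpSet.ordConnected.uIcc_subset ?_
      (interior_subset hRD'))
    simp [integrableExpSet]
  have hlines := verticalLines_subset_verticalStrip R
  have hσ2 : σ ^ 2 = variance (X 1) P := by rw [hσ, Real.sq_sqrt (variance_nonneg _ _)]
  obtain ⟨k, hk⟩ := hX.exists_isCumulantGenFun
  set K := tiltedCumulant (X 1) P with hKdef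
  have hK0 := fun z hz ↦ hX.hasDerivWithinAt_cumulantGenFun (z := z) hk hstrip hint hz
  have hKd : ∀ n ∈ Icc 1 3, ∀ z ∈ verticalStrip (2 * R),
      HasDerivWithinAt (K n) (K (n + 1) z) (verticalStrip (2 * R)) z := fun n hn z hz ↦
    hasDerivWithinAt_tiltedCumulant hM hint (hk.expMoment_zero_ne hstrip) hn hz
  have hKc : ∀ n, ContinuousOn (K n) (verticalStrip (2 * R)) :=
    continuousOn_tiltedCumulant hM hint (hk.expMoment_zero_ne hstrip)
  obtain ⟨C, hC⟩ := hX.exists_norm_tiltedCumulant_le hk hstrip hint ha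
  have hK1 : K 1 0 = μ := by rw [hKdef, tiltedCumulant_one_zero, hμ]
  have hK2 : K 2 0 = (σ : ℂ) ^ 2 := by
    rw [hKdef, tiltedCumulant_two_zero hL2, ← hσ2, Complex.ofReal_pow]
  -- the cumulant generating functions of the curve
  have hdrift := isCumulantGenFun_driftedProcess hW μ σ
  have hκ0 : κ 0 = cumulantGenFun (driftedProcess μ σ W) P' := by
    rw [hκ, hμ, hσ]
    simp [kappaFamily]
  have hκl : ∀ l ∈ Ioc (0 : ℝ) 1, κ l = cumulantGenFun (scaledProcess X P l) P := fun l hl ↦ by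
    rw [hκ]
    simp [kappaFamily, hl.1.ne']
  have hκ0' : IsCumulantGenFun (driftedProcess μ σ W) P' (κ 0) := hκ0 ▸ hdrift.cumulantGenFun
  have hκl' : ∀ l ∈ Ioc (0 : ℝ) 1, IsCumulantGenFun (scaledProcess X P l) P (κ l) := fun l hl ↦
    hκl l hl ▸ (hX.isCumulantGenFun_scaledProcess hk hl).cumulantGenFun
  have hdom0 : verticalLines R ⊆ expDomain (driftedProcess μ σ W) P' := by
    rw [expDomain_driftedProcess hW]
    exact subset_univ _
  have hdoml : ∀ l ∈ Ioc (0 : ℝ) 1, verticalLines R ⊆ expDomain (scaledProcess X P l) P :=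
    fun l hl z hz ↦ (hX.mem_expDomain_scaledProcess_iff hl).2
      (hstrip (smul_mem_verticalStrip (hlines hz) (Ioc_subset_Icc_self hl)))
  have hκ0z : ∀ z ∈ verticalLines R, κ 0 z = μ * z + 1 / 2 * σ ^ 2 * z ^ 2 := fun z hz ↦
    hκ0'.eqOn hdrift (hdom0 hz)
  -- For `l > 0` the linear Taylor term, divided by `l²`, cancels the drift `-μ z / l`; at `l = 0`
  -- the remainder integral equals `σ² / 2`.
  have hκD : ∀ z ∈ verticalLines R, EqOn (fun l ↦ κ l z) (fun l ↦ scaledDeriv K μ 0 l z)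
      (Icc 0 1) := by
    intro z hz l hl
    rcases hl.1.eq_or_lt with rfl | hpos
    · simp only [scaledDeriv, taylorRemainder_zero_right, hκ0z z hz]
      rw [zero_add, hK2]
      norm_num
      ring
    · have hl' : l ∈ Ioc (0 : ℝ) 1 := ⟨hpos, hl.2⟩
      have hne : (l : ℂ) ≠ 0 := by exact_mod_cast hpos.ne'
      have h1 := (hκl' l hl').eqOn (hX.isCumulantGenFun_scaledProcess hk hl') (hdoml l hl' hz)
      have h2 := eq_add_mul_taylorRemainder (K := K) hK0 (hKd 1 (by simp)) (hKc 2)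
        (hlines hz) hl
      simp only [scaledDeriv, h1, if_true, zero_add]
      rw [h2, hk.map_zero, hK1, ← hμ]
      field_simp
      ring
  have hD : ∀ z ∈ verticalLines R, ∀ n < 2, ∀ l ∈ Icc (0 : ℝ) 1, HasDerivWithinAt
      (fun l ↦ scaledDeriv K μ n l z) (scaledDeriv K μ (n + 1) l z) (Icc 0 1) l :=
    fun z hz n hn l hl ↦ hasDerivWithinAt_scaledDeriv _ (hKd (n + 2) ⟨by omega, by omega⟩)
      (hC (n + 3) ⟨by omega, by omega⟩) (hlines hz) hl
  have hDc : ∀ n ≤ 2, ContinuousOn (fun p : ℝ × ℂ ↦ scaledDeriv K μ n p.1 p.2)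
      (Icc 0 1 ×ˢ verticalLines R) := fun n hn ↦
    (continuousOn_scaledDeriv _ (hKc (n + 2)) (hC (n + 2) ⟨by omega, by omega⟩)).mono
      (prod_mono_right hlines)
  have hu : UniqueDiffOn ℝ (Icc (0 : ℝ) 1) := uniqueDiffOn_Icc zero_lt_one
  have hiter : ∀ z ∈ verticalLines R, ∀ n ≤ 2, ∀ l ∈ Icc (0 : ℝ) 1,
      iteratedDerivWithin n (fun l ↦ κ l z) (Icc 0 1) l = scaledDeriv K μ n l z :=
    fun z hz n hn l hl ↦ (iteratedDerivWithin_congr (hκD z hz) hl).trans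
      (iteratedDerivWithin_eq_of_hasDerivWithinAt hu (D := fun n l ↦ scaledDeriv K μ n l z)
        (hD z hz) n hn l hl)
  have zero_mem : (0 : ℝ) ∈ Icc (0 : ℝ) 1 := ⟨le_rfl, zero_le_one⟩
  -- In the constant `|μ| + C + 1`, the `1` only ensures strict positivity.
  refine ⟨⟨hκ0', hdom0⟩, fun l hl ↦ ⟨hκl' l hl, hdoml l hl⟩, fun z hz ↦ ?_, fun n hn ↦ ?_,
    fun z hz ↦ ⟨hκ0z z hz, ?_, ?_⟩, |μ| + C + 1, ?_, fun n hn l hl z hz ↦ ?_⟩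
  · refine ContDiffOn.congr ?_ (hκD z hz)
    exact contDiffOn_of_hasDerivWithinAt hu (N := 2) (D := fun n l ↦ scaledDeriv K μ n l z)
      (hD z hz) ((hDc 2 le_rfl).comp (f := fun l : ℝ ↦ (l, z)) (by fun_prop) fun l hl ↦ ⟨hl, hz⟩)
  · exact (hDc n hn).congr fun p hp ↦ hiter p.2 hp.2 n hn p.1 hp.1
  · rw [hiter z hz 1 (by simp) 0 zero_mem, scaledDeriv, taylorRemainder_zero_right, hKdef,
      tiltedCumulant_three_zero fun n hn ↦ hpow n (by omega), ← hμ]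
    norm_num
    ring
  · rw [hiter z hz 2 le_rfl 0 zero_mem, scaledDeriv, taylorRemainder_zero_right, hKdef,
      tiltedCumulant_four_zero hpow hL2, ← hμ, ← hσ2]
    norm_num
    ring
  · have := (norm_nonneg _).trans (hC 2 (by simp) 0 (by simp [verticalStrip]))
    positivity
  · rw [hiter z hz n hn l hl]
    refine (norm_scaledDeriv_le (μ : ℂ) (hC (n + 2) ⟨by omega, by omega⟩) (hlines hz) hl).trans ?_
    rw [Complex.norm_real, Real.norm_eq_abs]
    exact mul_le_mul_of_nonneg_right (by linarith) (by positivity)
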